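/- **DiP automata.** A DiPA $\mathcal A$ has a finite set $Q$ of states, partitioned into input and non-input states, an initial state $q_{\mathrm{init}}$, a finite output alphabet $\Gamma$, storage variables $x_1,\dots,x_k$, parameters $(d,\mu,d',\mu')\in\mathbb Q^{\ge 0}\times\mathbb Q\times\mathbb Q^{\ge 0}\times\mathbb Q$ for each state, and a partial transition function $\delta$ with $\delta(q,c)=(q',o,b)$, where the guard $c$ is a conjunction containing for each $i$ at most one of $s\ge x_i$, $s<x_i$ (the empty conjunction is $\mathsf{true}$), $o\in\Gamma\cup\{s,s'\}$, and $b\in\{\mathsf{true},\mathsf{false}\}^k$. Distinct guards of transitions from one state are jointly unsatisfiable, and transitions from non-input states have guard $\mathsf{true}$. With privacy parameter $\epsilon>0$, in each step $s\sim \mathrm{Lap}(d\epsilon,\mu)$ and $s'\sim\mathrm{Lap}(d'\epsilon,\mu')$ are sampled independently, where $\mathrm{Lap}(\kappa,m)$ has density $\frac{\kappa}{2}e^{-\kappa|z-m|}$; an input state reads a real $a$, which is added to $s$ and $s'$, and a non-input state reads $\tau$. A transition whose guard holds outputs $o$, moves to $q'$ and stores $s$ in all $x_i$ with $b_i=\mathsf{true}$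 ("assigns" them). A run is a sequence of consecutive transitions; a cycle is a nonempty run that ends in the state in which it starts. For a run $\rho$ of length $n$, $\mathsf{last}_\rho(x,j)$ is the largest $i<j$ such that $\rho[i]$ assigns $x$, or $-\infty$ if there is none. The dependency graph $G_\rho$ on $\{0,\dots,n-1\}$ has, for each $j$, an edge $j\to \mathsf{last}_\rho(x,j)$ for each conjunct $s<x$ of the guard of $\rho[j]$ and an edge $\mathsf{last}_\rho(x,j)\to j$ for each conjunct $s\ge x$ (whenever $\mathsf{last}_\rho(x,j)\neq-\infty$). $\rho$ is feasible if $G_\rho$ is acyclic. As standing assumptions, $\mathcal A$ is initialized (on every run from $q_{\mathrm{init}}$ each variable is assigned before it is referenced in a guard) and satisfies strong feasibility (for every feasible run $\rho$ from $q_{\mathrm{init}}$, if $G_\rho$ has a path of nonzero length from $i$ to $j$ and the transitions $\rho[i],\rho[j]$ start in non-input states, then the parameters $\mu$ of these states satisfy $\mu_i<\mu_j$). **Well-formedness.** A cycle $C$ is non-leaking if for each $i$ and each variable $x$ referenced in the guard of $(CC)[i]$, $\mathsf{last}_{CC}(x,i)=-\infty$. All runs below start in $q_{\mathrm{init}}$;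 $\rho[i:j]=\rho[i]\cdots\rho[j-1]$; paths $k_1,\dots,k_m$ are in $G_\rho$ with $m\ge2$. $\mathcal A$ is well-formed if it has none of the following. * *Leaking cycle:* a run $\rho$ with a suffix $C=\rho[j:n]$ that is a cycle in which some variable is both assigned and referenced (in either order), such that $\rho C^m$ is feasible for all $m\ge0$. * *Leaking pair:* a feasible run $\rho$ with disjoint non-leaking cycles $\rho[i_1:j_1]$, $\rho[i_2:j_2]$ ($j_1\le i_2$ or $j_2\le i_1$) and a path $k_1,\dots,k_m$ with $i_1\le k_1<j_1$, $i_2\le k_m<j_2$, $k_2<k_1$, $k_{m-1}<k_m$. * *Disclosing cycle:* a feasible run with a suffix that is a non-leaking cycle containing a transition from an input state that outputs $s$ or $s'$. * *Privacy violating path:* a feasible run $\rho$ with a non-leaking cycle $\rho[i:j]$ and a path $k_1,\dots,k_m$ such that either $\rho[k_1]$ outputs $s$, $k_{m-1}<k_m$ and $i\le k_m<j$, or $i\le k_1<j$, $k_2<k_1$ and $\rho[k_m]$ outputs $s$. **Differential privacy.** For an input sequence $\alpha\in(\mathbb R\cup\{\tau\})^*$ and an output sequence $\gamma$ over $\Gamma\cup[-\infty,\infty]^2$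 of the same length, let $\mathsf{Pr}_\epsilon(\alpha,\gamma)$ be the sum, over all runs from $q_{\mathrm{init}}$ that can read $\alpha$ and whose outputs match $\gamma$, of the probability that on input $\alpha$ the run is followed and its real outputs lie in the open intervals $(v,w)$ given by $\gamma$. $\mathcal A$ is $\mathfrak D\epsilon$-differentially private if $\mathsf{Pr}_\epsilon(\alpha,\gamma)\le e^{\mathfrak D\epsilon}\,\mathsf{Pr}_\epsilon(\beta,\gamma)$ for all $\gamma$ and all adjacent $\alpha,\beta$, that is, sequences of equal length with $\tau$ at the same positions and reals differing by at most $1$ at all others. **Theorem 5.1.** Let $\mathcal A$ be a DiPA (initialized and satisfying strong feasibility). If $\mathcal A$ is well-formed, then there is $\mathfrak D>0$ such that $\mathcal A$ is $\mathfrak D\epsilon$-differentially private for every $\epsilon>0$. Further, such a $\mathfrak D$ can be computed in time exponential in the size of $\mathcal A$: there is a Turing machine that, given a binary encoding of length $n$ of a finite presentation of a DiPA $\mathcal A$, halts after at most $2^{p(n)}$ steps, for a fixed polynomial $p$, with (the binary encoding of) a rational number $\mathfrak D(\mathcal A)$ as output, and whenever $\mathcal A$ is well-formed (and satisfies the standing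 assumptions), $\mathfrak D(\mathcal A)>0$ and $\mathcal A$ is $\mathfrak D(\mathcal A)\epsilon$-differentially private for every $\epsilon>0$. -/

import Mathlib

open scoped ENNReal

/-! ### Syntax of DiP automata -/

/-- The two ways in which the sampled value can be compared with a storage variable `x`:
`ge` is the constraint `sample ≥ x` and `lt` is the constraint `sample < x`. -/
inductive Cmp
  | ge
  | lt

/-- A guard over `k` storage variables: a conjunction that contains, for each variable, at most
one of the two constraints. The empty conjunction is the guard `true`. -/
abbrev Guard (k : ℕ) := Fin k → Option Cmp

/-- The guard `true`. -/
def Guard.trivial (k : ℕ) : Guard k := fun _ => none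

/-- The guard `c` holds when the sampled value is `s` and the stored values are `η`. -/
def Guard.Holds {k : ℕ} (c : Guard k) (s : ℝ) (η : Fin k → ℝ) : Prop :=
  ∀ x, (c x = some Cmp.ge → η x ≤ s) ∧ (c x = some Cmp.lt → s < η x)

/-- The output of a transition: a symbol of the output alphabet, or one of the two values that
are sampled in the step. -/
inductive Output (Γ : Type*)
  | symbol (a : Γ)
  | sample
  | sample'

/-- Parameters of a state: `sample` is drawn from `Lap(d ε, μ)` and `sample'` is drawn from
`Lap(d' ε, μ')`. -/
structure Params where
  d : NNRat
  μ : ℚ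
  d' : NNRat
  μ' : ℚ

/-- A DiP automaton with states `Q`, output alphabet `Γ` and `k` storage variables. `Q` and `Γ`
are required to be finite where the automaton is used. `δ q c = some (q', o, b)` says that in
state `q` there is a transition with guard `c` to `q'` that outputs `o` and stores the sampled
value in the variables `x` with `b x = true`. -/
structure DiPA (Q Γ : Type*) (k : ℕ) where
  isInput : Q → Bool
  init : Q
  params : Q → Params
  δ : Q → Guard k → Option (Q × Output Γ × (Fin k → Bool))
  /-- distinct guards of transitions from one state are jointly unsatisfiable -/
  deterministic : ∀ q c c', (δ q c).isSome → (δ q c').isSome →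
    c = c' ∨ ¬ ∃ (s : ℝ) (η : Fin k → ℝ), Guard.Holds c s η ∧ Guard.Holds c' s η
  /-- a transition from a non-input state has guard `true` -/
  nonInput : ∀ q, isInput q = false → ∀ c, (δ q c).isSome → c = Guard.trivial k

/-- A transition, as a quintuple. -/
@[ext] structure Transition (Q Γ : Type*) (k : ℕ) where
  src : Q
  guard : Guard k
  trg : Q
  out : Output Γ
  assign : Fin k → Bool

namespace Transition

variable {Q Γ : Type*} {k : ℕ}

/-- Variables that bound the sampled value from below. -/
def smallv (t : Transition Q Γ k) : Set (Fin k) := {x | t.guard x = some Cmp.ge}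

/-- Variables that bound the sampled value from above. -/
def largev (t : Transition Q Γ k) : Set (Fin k) := {x | t.guard x = some Cmp.lt}

/-- Variables that are referenced in the guard. -/
def usedv (t : Transition Q Γ k) : Set (Fin k) := t.smallv ∪ t.largev

/-- Variables that the transition assigns. -/
def assignv (t : Transition Q Γ k) : Set (Fin k) := {x | t.assign x = true}

/-- The valuation after the transition when the sampled value is `z`. -/
def store (t : Transition Q Γ k) (η : Fin k → ℝ) (z : ℝ) : Fin k → ℝ :=
  fun x => if t.assign x then z else η x

end Transition

/-! ### Runs and dependency graphs -/

section Runs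

variable {Q Γ : Type*} {k : ℕ}

/-- The last position before `j` at which `ρ` assigns `x`; it is `⊥` (that is, `-∞`) if there is
none. -/
def lastAssign (ρ : List (Transition Q Γ k)) (x : Fin k) (j : ℕ) : WithBot ℕ :=
  ((Finset.range j).filter fun i => (ρ[i]?).any fun t => t.assign x).max

/-- The edge relation of the dependency graph of `ρ`, whose vertices are the positions of `ρ`.
An edge from `i` to `j` says that the guards force the value sampled at `i` to lie below the one
sampled at `j`. -/
def DepEdge (ρ : List (Transition Q Γ k)) (i j : ℕ) : Prop :=
  (∃ t x, ρ[i]? = some t ∧ x ∈ t.largev ∧ lastAssign ρ x i = (j : WithBot ℕ)) ∨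
  (∃ t x, ρ[j]? = some t ∧ x ∈ t.smallv ∧ lastAssign ρ x j = (i : WithBot ℕ))

/-- `κ 1, κ 2, …, κ m` is a path of the dependency graph of `ρ` with at least one edge. -/
def IsDepPath (ρ : List (Transition Q Γ k)) (m : ℕ) (κ : ℕ → ℕ) : Prop :=
  2 ≤ m ∧ ∀ r, 1 ≤ r → r < m → DepEdge ρ (κ r) (κ (r + 1))

/-- The subsequence `ρ[i], …, ρ[j - 1]`. -/
def slice (ρ : List (Transition Q Γ k)) (i j : ℕ) : List (Transition Q Γ k) :=
  (ρ.take j).drop i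

/-- The concatenation of `m` copies of `C`. -/
def repeatRun (m : ℕ) (C : List (Transition Q Γ k)) : List (Transition Q Γ k) :=
  (List.replicate m C).flatten

end Runs

/-- The letters of output sequences: a symbol, or an interval `(v, w)` with `v, w ∈ [-∞, ∞]` in
which a real output is required to lie. -/
abbrev OutLetter (Γ : Type*) := Γ ⊕ (EReal × EReal)

/-- The interval in which the output letter `o` confines a real output. -/
noncomputable def outBounds {Γ : Type*} : OutLetter Γ → EReal × EReal
  | Sum.inl _ => (⊥, ⊤)
  | Sum.inr I => I

/-- The output of a transition matches a letter of an output sequence. -/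
def OutMatches {Γ : Type*} : Output Γ → OutLetter Γ → Prop
  | Output.symbol a, Sum.inl b => a = b
  | Output.sample, Sum.inr _ => True
  | Output.sample', Sum.inr _ => True
  | _, _ => False

/-- The density of the Laplace distribution with scaling parameter `κ` and mean `m`. -/
noncomputable def laplaceDensity (κ m z : ℝ) : ℝ≥0∞ :=
  ENNReal.ofReal (κ / 2 * Real.exp (-κ * |z - m|))

/-- The real numbers strictly between `l` and `u`. -/
def between (l u : EReal) : Set ℝ := {z | l < (z : EReal) ∧ (z : EReal) < u}

/-- Letters of input sequences: `some a` is the real number `a` and `none` is the letter `τ`.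
Two letters are adjacent if both are `τ` or both are reals at distance at most `1`. -/
def AdjacentLetter : Option ℝ → Option ℝ → Prop
  | none, none => True
  | some a, some b => |a - b| ≤ 1
  | _, _ => False

/-- Adjacency of input sequences. -/
def Adjacent (α β : List (Option ℝ)) : Prop := List.Forall₂ AdjacentLetter α β

namespace DiPA

variable {Q Γ : Type*} {k : ℕ}

/-- `t` is a transition of `A`. -/
def IsTransition (A : DiPA Q Γ k) (t : Transition Q Γ k) : Prop :=
  A.δ t.src t.guard = some (t.trg, t.out, t.assign)

/-- Runs of `A`. -/
def IsRun (A : DiPA Q Γ k) (ρ : List (Transition Q Γ k)) : Prop :=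
  (∀ t ∈ ρ, A.IsTransition t) ∧ ρ.IsChain fun t t' => t.trg = t'.src

/-- Runs of `A` from the initial state. -/
def IsInitRun (A : DiPA Q Γ k) (ρ : List (Transition Q Γ k)) : Prop :=
  A.IsRun ρ ∧ ∀ t, ρ.head? = some t → t.src = A.init

/-- A cycle is a (nonempty) run that ends in the state in which it starts. -/
def IsCycle (A : DiPA Q Γ k) (C : List (Transition Q Γ k)) : Prop :=
  A.IsRun C ∧ ∃ h : C ≠ [], (C.head h).src = (C.getLast h).trg

/-- On every run from the initial state, a variable is assigned before it is referenced. -/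
def Initialized (A : DiPA Q Γ k) : Prop :=
  ∀ ρ, A.IsInitRun ρ → ∀ (i : ℕ) (t : Transition Q Γ k) (x : Fin k), ρ[i]? = some t → x ∈ t.usedv →
    ∃ j < i, ∃ t' : Transition Q Γ k, ρ[j]? = some t' ∧ x ∈ t'.assignv

/-- A run is feasible if its dependency graph is acyclic. -/
def Feasible (A : DiPA Q Γ k) (ρ : List (Transition Q Γ k)) : Prop :=
  A.IsRun ρ ∧ ∀ i, ¬ Relation.TransGen (DepEdge ρ) i i

/-- Whenever there is a path of the dependency graph between positions of non-input transitions,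
the means of the distributions of the sampled values are ordered in the same way. -/
def StronglyFeasible (A : DiPA Q Γ k) (ρ : List (Transition Q Γ k)) : Prop :=
  A.Feasible ρ ∧ ∀ (i j : ℕ) (t t' : Transition Q Γ k), Relation.TransGen (DepEdge ρ) i j →
    ρ[i]? = some t → ρ[j]? = some t' → A.isInput t.src = false → A.isInput t'.src = false →
    (A.params t.src).μ < (A.params t'.src).μ

/-- The strong feasibility assumption: all feasible runs from the initial state are strongly
feasible. -/
def StrongFeasibility (A : DiPA Q Γ k) : Prop :=
  ∀ ρ, A.IsInitRun ρ → A.Feasible ρ → A.StronglyFeasible ρ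

/-! ### Well-formedness -/

/-- The run `ρ` from the initial state is a leaking cycle. -/
def IsLeakingCycle (A : DiPA Q Γ k) (ρ : List (Transition Q Γ k)) : Prop :=
  A.IsInitRun ρ ∧ ∃ j < ρ.length, ∃ x : Fin k,
    A.IsCycle (ρ.drop j) ∧
    (∃ i₁ ≥ j, ∃ t : Transition Q Γ k, ρ[i₁]? = some t ∧ x ∈ t.assignv) ∧
    (∃ i₂ ≥ j, ∃ t : Transition Q Γ k, ρ[i₂]? = some t ∧ x ∈ t.usedv) ∧
    ∀ m : ℕ, A.Feasible (ρ ++ repeatRun m (ρ.drop j))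

/-- `C` is a cycle, and no variable that it references is assigned in it; two copies of `C` are
inspected, so that also assignments after the reference count. -/
def IsNonLeakingCycle (A : DiPA Q Γ k) (C : List (Transition Q Γ k)) : Prop :=
  A.IsCycle C ∧ ∀ x i t, (C ++ C)[i]? = some t → x ∈ t.usedv → lastAssign (C ++ C) x i = ⊥

/-- The run `ρ` from the initial state is a leaking pair. -/
def IsLeakingPair (A : DiPA Q Γ k) (ρ : List (Transition Q Γ k)) : Prop :=
  A.IsInitRun ρ ∧ A.Feasible ρ ∧ ∃ i₁ j₁ i₂ j₂ : ℕ,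
    i₁ < j₁ ∧ j₁ ≤ ρ.length ∧ i₂ < j₂ ∧ j₂ ≤ ρ.length ∧
    A.IsNonLeakingCycle (slice ρ i₁ j₁) ∧ A.IsNonLeakingCycle (slice ρ i₂ j₂) ∧
    (j₁ ≤ i₂ ∨ j₂ ≤ i₁) ∧
    ∃ m κ, IsDepPath ρ m κ ∧ (i₁ ≤ κ 1 ∧ κ 1 < j₁) ∧ (i₂ ≤ κ m ∧ κ m < j₂) ∧
      κ 2 < κ 1 ∧ κ (m - 1) < κ m

/-- The run `ρ` from the initial state is a disclosing cycle. -/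
def IsDisclosingCycle (A : DiPA Q Γ k) (ρ : List (Transition Q Γ k)) : Prop :=
  A.IsInitRun ρ ∧ A.Feasible ρ ∧ ∃ j i : ℕ, j ≤ i ∧ i < ρ.length ∧
    A.IsNonLeakingCycle (ρ.drop j) ∧
    ∃ t : Transition Q Γ k, ρ[i]? = some t ∧ A.isInput t.src = true ∧
      (t.out = Output.sample ∨ t.out = Output.sample')

/-- The run `ρ` from the initial state is a privacy violating path. -/
def IsPrivacyViolatingPath (A : DiPA Q Γ k) (ρ : List (Transition Q Γ k)) : Prop :=
  A.IsInitRun ρ ∧ A.Feasible ρ ∧ ∃ i j : ℕ, i ≤ j ∧ j ≤ ρ.length ∧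
    A.IsNonLeakingCycle (slice ρ i j) ∧
    ∃ m κ, IsDepPath ρ m κ ∧
      (((∃ t : Transition Q Γ k, ρ[κ 1]? = some t ∧ t.out = Output.sample) ∧ κ (m - 1) < κ m ∧
          i ≤ κ m ∧ κ m < j) ∨
        (i ≤ κ 1 ∧ κ 1 < j ∧ κ 2 < κ 1 ∧
          ∃ t : Transition Q Γ k, ρ[κ m]? = some t ∧ t.out = Output.sample))

/-- Well-formed automata. -/
def WellFormed (A : DiPA Q Γ k) : Prop :=
  (∀ ρ, ¬ A.IsLeakingCycle ρ) ∧ (∀ ρ, ¬ A.IsLeakingPair ρ) ∧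
  (∀ ρ, ¬ A.IsDisclosingCycle ρ) ∧ (∀ ρ, ¬ A.IsPrivacyViolatingPath ρ)

/-! ### Semantics -/

/-- `ρ` is a run on the input sequence `α` that produces the output sequence `γ`. -/
def IsRunOn (A : DiPA Q Γ k) (ρ : List (Transition Q Γ k)) (α : List (Option ℝ))
    (γ : List (OutLetter Γ)) : Prop :=
  A.IsRun ρ ∧ ρ.length = α.length ∧ ρ.length = γ.length ∧
  (∀ (i : ℕ) (t : Transition Q Γ k) (a : Option ℝ), ρ[i]? = some t → α[i]? = some a →
    (a = none ↔ A.isInput t.src = false)) ∧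
  (∀ (i : ℕ) (t : Transition Q Γ k) (o : OutLetter Γ), ρ[i]? = some t → γ[i]? = some o →
    OutMatches t.out o)

/-- The probability of the computation `(ρ, α, γ)` for the privacy parameter `ε` when the initial
valuation of the storage variables is `η`. Suprema over the empty set are `-∞` and infima are
`∞`; the integral between bounds in the wrong order is `0`. Only the values for sequences `ρ`, `α`
and `γ` of equal length matter. -/
noncomputable def prob (A : DiPA Q Γ k) (ε : ℝ) :
    List (Transition Q Γ k) → List (Option ℝ) → List (OutLetter Γ) → (Fin k → ℝ) → ℝ≥0∞
  | t :: ρ, a :: α, o :: γ, η =>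
    let P := A.params t.src
    let a₀ : ℝ := a.getD 0
    let v : EReal := (outBounds o).1
    let w : EReal := (outBounds o).2
    let low : EReal := ⨆ x ∈ t.smallv, (η x : EReal)
    let up : EReal := ⨅ x ∈ t.largev, (η x : EReal)
    let integral : EReal → EReal → ℝ≥0∞ := fun l u =>
      ∫⁻ z in between l u, laplaceDensity (P.d * ε) (P.μ + a₀) z * prob A ε ρ α γ (t.store η z)
    match t.out with
    | Output.sample' =>
      (∫⁻ z in between v w, laplaceDensity (P.d' * ε) (P.μ' + a₀) z) * integral low up
    | _ => integral (max low v) (min up w)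
  | _, _, _, _ => 1

/-- The runs from the initial state on `α` that produce `γ`. -/
def runs (A : DiPA Q Γ k) (α : List (Option ℝ)) (γ : List (OutLetter Γ)) :
    Set (List (Transition Q Γ k)) :=
  {ρ | A.IsInitRun ρ ∧ A.IsRunOn ρ α γ}

/-- `A` is `D ε`-differentially private. The probability of a run from the initial state of an
initialized automaton does not depend on the initial valuation `η`. -/
def DifferentiallyPrivate (A : DiPA Q Γ k) (D ε : ℝ) : Prop :=
  ∀ (α β : List (Option ℝ)) (γ : List (OutLetter Γ)) (η : Fin k → ℝ), Adjacent α β →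
    ∑' ρ : A.runs α γ, A.prob ε ρ α γ η ≤
      ENNReal.ofReal (Real.exp (D * ε)) * ∑' ρ : A.runs β γ, A.prob ε ρ β γ η

end DiPA

/-! ### Automata as inputs of algorithms -/

/-- A finite sequence of numbers as a word: each number is written in binary and followed by a
separator `none`. -/
def encodeNumbers (l : List ℕ) : List (Option Bool) :=
  l.flatMap fun n => (Nat.bits n).map some ++ [none]

/-- An integer as two numbers, its sign and its absolute value. -/
def intNumbers (z : ℤ) : List ℕ := [if z < 0 then 1 else 0, z.natAbs]

/-- A rational number as a fraction in lowest terms. -/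
def ratNumbers (q : ℚ) : List ℕ := intNumbers q.num ++ [q.den]

/-- The encoding of a rational number. -/
def encodeRat (q : ℚ) : List (Option Bool) := encodeNumbers (ratNumbers q)

/-- A finite presentation of a DiP automaton: states, symbols and variables are numbered, and the
transitions are listed (without repetition, in any order). Every automaton with finitely many
states and symbols has one, after a renaming of states and symbols. -/
structure Presentation where
  numStates : ℕ
  numSymbols : ℕ
  numVars : ℕ
  automaton : DiPA (Fin numStates) (Fin numSymbols) numVars
  transitions : List (Transition (Fin numStates) (Fin numSymbols) numVars)
  nodup : transitions.Nodup
  mem_transitions : ∀ t, t ∈ transitions ↔ automaton.IsTransition t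

/-- The data of a state: its kind and its parameters. -/
def stateNumbers {Q Γ : Type*} {k : ℕ} (A : DiPA Q Γ k) (q : Q) : List ℕ :=
  (if A.isInput q then 1 else 0) ::
    ([(A.params q).d.num, (A.params q).d.den] ++ ratNumbers (A.params q).μ ++
     [(A.params q).d'.num, (A.params q).d'.den] ++ ratNumbers (A.params q).μ')

/-- A constraint on one variable as a number. -/
def constraintNumber : Option Cmp → ℕ
  | none => 0
  | some Cmp.ge => 1
  | some Cmp.lt => 2

/-- The output of a transition as a number. -/
def outputNumber {m : ℕ} : Output (Fin m) → ℕ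
  | Output.sample => 0
  | Output.sample' => 1
  | Output.symbol a => (a : ℕ) + 2

/-- The data of a transition. -/
def transitionNumbers {n m k : ℕ} (t : Transition (Fin n) (Fin m) k) : List ℕ :=
  [(t.src : ℕ), (t.trg : ℕ), outputNumber t.out] ++
    (List.ofFn fun x => constraintNumber (t.guard x)) ++
    (List.ofFn fun x => if t.assign x then 1 else 0)

/-- All data of a presentation. -/
def Presentation.numbers (M : Presentation) : List ℕ :=
  [M.numStates, M.numSymbols, M.numVars, (M.automaton.init : ℕ)] ++
    (List.finRange M.numStates).flatMap (stateNumbers M.automaton) ++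
    M.transitions.flatMap transitionNumbers

/-- The encoding of a presentation. The length of this word is the size of the automaton. -/
def Presentation.encode (M : Presentation) : List (Option Bool) := encodeNumbers M.numbers

/-- `f` is computed, with respect to the encodings `ea` and `eb`, by a Turing machine that runs in
exponential time: on inputs of size `n` it makes at most `2 ^ p(n)` steps for some polynomial
`p`. -/
def ComputableInExpTime {X Y S T : Type} (ea : X → List S) (eb : Y → List T) (f : X → Y) : Prop :=
  ∃ (M : Turing.TM2ComputableInTime ea eb f) (p : Polynomial ℕ), ∀ n, M.time n ≤ 2 ^ p.eval n

/-!
The proof couples the computations on two adjacent inputs run by run. Along a run `ρ` the value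
sampled at position `i` is shifted by some `h i ∈ [-1, 1]`. If `h` is monotone along the edges of
the dependency graph and vanishes where `sample` is output, then a translation of the integration
variables shows that the probability of `ρ` changes at most by the factor `exp (ε c)`, where `c`
adds up the products of the scaling parameters with the differences between `h i` and the change of
the input (`DiPA.prob_le_of_isShift`). Runs that are not feasible have probability `0`
(`DiPA.exists_strictExec_of_prob_ne_zero`), so it remains to find, for feasible runs, shifts whose
cost is bounded independently of the run.

A position is *free* if it lies in a non-leaking cycle and no later guard refers to its sample. Free
positions follow the input (a change of at most `1`) and cost nothing. The others are shifted by `1`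
if they can be reached from a free position in the dependency graph, by `-1` if they can reach a
free position, and by `0` otherwise (`DiPA.shift`). Well-formedness makes this a valid choice
(`DiPA.WellFormed.isShift`): a path between two free positions would be a leaking pair, once a cycle
has been duplicated to make the two cycles disjoint (`DiPA.WellFormed.not_path_of_freeAt`); a path
between a free position and one that outputs `sample` is a privacy violating path; a free input
position with a real output gives a disclosing cycle.

The number of positions that are not free is bounded (`DiPA.WellFormed.card_not_freeAt_le`). Fix an
execution of `ρ` that satisfies all guards strictly, and let the configuration at a position consist
of the state and the order of the stored values. A piece of `ρ` between two positions with the same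
configuration is a cycle that can be repeated forever, because the order of the stored values
determines how the execution can be continued; if some variable were both assigned and referenced
in it, it would be a leaking cycle (`DiPA.WellFormed.nonLeakingAt`). Hence positions outside of
non-leaking cycles have different configurations, and so have the successors of positions that
assign a given variable for a later reference. There are at most `|Q| * 2 ^ (k * k)` configurations.

The resulting privacy loss is at most `2 ^ 2 ^ n` for an automaton whose encoding has length `n`.
This number depends only on `n` and has `2 ^ n + 1` binary digits, and a machine that doubles a
block of digits for each letter of its input writes it down in exponential time
(`computableInExpTime_two_pow_two_pow`).
-/

/-! ### Positions of a run and stored values -/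

section Positions

variable {Q Γ : Type*} {k : ℕ}

/-- The transition at position `i` of `ρ` assigns `x`. -/
def AssignsAt (ρ : List (Transition Q Γ k)) (i : ℕ) (x : Fin k) : Prop :=
  ∃ t, ρ[i]? = some t ∧ x ∈ t.assignv

/-- The guard of the transition at position `i` of `ρ` references `x`. -/
def UsesAt (ρ : List (Transition Q Γ k)) (i : ℕ) (x : Fin k) : Prop :=
  ∃ t, ρ[i]? = some t ∧ x ∈ t.usedv

/-- The value of `x` just before position `i` of `ρ` when the values `v` are sampled and the
initial valuation is `η₀`. -/
noncomputable def stored (ρ : List (Transition Q Γ k)) (v : ℕ → ℝ) (η₀ : Fin k → ℝ) (i : ℕ) :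
    Fin k → ℝ :=
  fun x => (lastAssign ρ x i).recBotCoe (η₀ x) v

variable {ρ : List (Transition Q Γ k)} {x : Fin k} {i j : ℕ}

lemma lastAssign_eq_bot : lastAssign ρ x j = ⊥ ↔ ∀ i < j, ¬ AssignsAt ρ i x := by
  simp only [lastAssign, Finset.max_eq_bot, Finset.filter_eq_empty_iff, Finset.mem_range,
    AssignsAt, Transition.assignv, Set.mem_ofPred_eq, Option.any_eq_true]

lemma lastAssign_eq_coe : lastAssign ρ x j = (i : WithBot ℕ) ↔
    i < j ∧ AssignsAt ρ i x ∧ ∀ i', i < i' → i' < j → ¬ AssignsAt ρ i' x := by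
  have key : ∀ i, i ∈ (Finset.range j).filter (fun i => (ρ[i]?).any fun t => t.assign x) ↔
      i < j ∧ AssignsAt ρ i x := by
    intro i
    simp only [Finset.mem_filter, Finset.mem_range, AssignsAt, Transition.assignv,
      Set.mem_ofPred_eq, Option.any_eq_true]
  constructor
  · intro h
    have h1 := (key i).1 (Finset.mem_of_max h)
    refine ⟨h1.1, h1.2, fun i' hi hj ha => ?_⟩
    have : i' ≤ i := Finset.le_max_of_eq ((key i').2 ⟨hj, ha⟩) h
    omega
  · rintro ⟨h1, h2, h3⟩
    refine le_antisymm (Finset.max_le fun a ha => ?_) (Finset.le_max ((key i).2 ⟨h1, h2⟩))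
    rw [key] at ha
    by_contra hlt
    exact h3 a (WithBot.coe_lt_coe.1 (not_le.1 hlt)) ha.1 ha.2

lemma lastAssign_cases (ρ : List (Transition Q Γ k)) (x : Fin k) (j : ℕ) :
    lastAssign ρ x j = ⊥ ∨ ∃ i : ℕ, lastAssign ρ x j = (i : WithBot ℕ) := by
  by_cases h : lastAssign ρ x j = ⊥
  · exact Or.inl h
  · obtain ⟨i, hi⟩ := WithBot.ne_bot_iff_exists.1 h
    exact Or.inr ⟨i, hi.symm⟩

lemma exists_lastAssign {i' : ℕ} (h : i' < j) (ha : AssignsAt ρ i' x) :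
    ∃ i : ℕ, lastAssign ρ x j = (i : WithBot ℕ) := by
  exact (lastAssign_cases ρ x j).resolve_left fun h0 => lastAssign_eq_bot.1 h0 i' h ha

lemma lastAssign_succ_of_assignsAt (h : AssignsAt ρ j x) :
    lastAssign ρ x (j + 1) = (j : WithBot ℕ) :=
  lastAssign_eq_coe.2 ⟨by omega, h, fun i' _ _ => by omega⟩

lemma lastAssign_succ_of_not_assignsAt (h : ¬ AssignsAt ρ j x) :
    lastAssign ρ x (j + 1) = lastAssign ρ x j := by
  rcases lastAssign_cases ρ x j with hl | ⟨i, hl⟩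
  · rw [hl]
    rw [lastAssign_eq_bot] at hl ⊢
    intro i hi
    rcases Nat.lt_succ_iff_lt_or_eq.1 hi with h' | rfl
    exacts [hl i h', h]
  · rw [hl]
    rw [lastAssign_eq_coe] at hl ⊢
    refine ⟨by omega, hl.2.1, fun i' h1 h2 => ?_⟩
    rcases Nat.lt_succ_iff_lt_or_eq.1 h2 with h' | rfl
    exacts [hl.2.2 i' h1 h', h]

/-- The position of the last assignment depends only on the part of the run before it. -/
lemma lastAssign_congr {σ : List (Transition Q Γ k)} (h : ∀ i < j, ρ[i]? = σ[i]?) :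
    lastAssign ρ x j = lastAssign σ x j := by
  unfold lastAssign
  congr 1
  refine Finset.filter_congr fun i hi => ?_
  rw [h i (Finset.mem_range.1 hi)]

lemma stored_zero (v : ℕ → ℝ) (η₀ : Fin k → ℝ) : stored ρ v η₀ 0 = η₀ := by
  funext x
  have : lastAssign ρ x 0 = ⊥ := lastAssign_eq_bot.2 fun i hi => by omega
  simp [stored, this]

lemma stored_of_lastAssign (v : ℕ → ℝ) (η₀ : Fin k → ℝ) (h : lastAssign ρ x j = (i : WithBot ℕ)) :
    stored ρ v η₀ j x = v i := by
  simp only [stored, h]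
  rfl

lemma stored_succ {t : Transition Q Γ k} (ht : ρ[i]? = some t) (v : ℕ → ℝ) (η₀ : Fin k → ℝ) :
    stored ρ v η₀ (i + 1) = t.store (stored ρ v η₀ i) (v i) := by
  funext x
  by_cases h : t.assign x = true
  · rw [stored_of_lastAssign v η₀ (lastAssign_succ_of_assignsAt ⟨t, ht, h⟩)]
    simp [Transition.store, h]
  · have : ¬ AssignsAt ρ i x := by
      rintro ⟨t', ht', hx⟩
      rw [ht] at ht'
      cases ht'
      exact h hx
    simp [stored, lastAssign_succ_of_not_assignsAt this, Transition.store, h]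

lemma stored_congr {σ : List (Transition Q Γ k)} {v w : ℕ → ℝ} (η₀ : Fin k → ℝ)
    (h : ∀ i < j, ρ[i]? = σ[i]?) (hv : ∀ i < j, v i = w i) :
    stored ρ v η₀ j = stored σ w η₀ j := by
  funext x
  simp only [stored, ← lastAssign_congr (x := x) h]
  rcases lastAssign_cases ρ x j with hl | ⟨i, hl⟩
  · rw [hl]
    rfl
  · rw [hl]
    exact hv i (lastAssign_eq_coe.1 hl).1

end Positions

/-! ### Executions and feasibility -/

section Executions

variable {Q Γ : Type*} {k : ℕ}

/-- With the initial valuation `η₀`, the sampled values `v` satisfy all constraints in the guards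
of `ρ` strictly. -/
def StrictExec (ρ : List (Transition Q Γ k)) (v : ℕ → ℝ) (η₀ : Fin k → ℝ) : Prop :=
  ∀ i t, ρ[i]? = some t → (∀ x ∈ t.smallv, stored ρ v η₀ i x < v i) ∧
    ∀ x ∈ t.largev, v i < stored ρ v η₀ i x

variable {ρ : List (Transition Q Γ k)} {v : ℕ → ℝ} {η₀ : Fin k → ℝ}

lemma StrictExec.lt_of_depEdge (h : StrictExec ρ v η₀) {i j : ℕ} (e : DepEdge ρ i j) :
    v i < v j := by
  rcases e with ⟨t, x, ht, hx, hl⟩ | ⟨t, x, ht, hx, hl⟩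
  · simpa [stored_of_lastAssign v η₀ hl] using (h i t ht).2 x hx
  · simpa [stored_of_lastAssign v η₀ hl] using (h j t ht).1 x hx

lemma StrictExec.acyclic (h : StrictExec ρ v η₀) (i : ℕ) :
    ¬ Relation.TransGen (DepEdge ρ) i i := by
  intro hc
  have : ∀ j, Relation.TransGen (DepEdge ρ) i j → v i < v j := by
    intro j hj
    induction hj with
    | single e => exact h.lt_of_depEdge e
    | tail _ e ih => exact ih.trans (h.lt_of_depEdge e)
  exact lt_irrefl _ (this i hc)

lemma DepEdge.lt_length {i j : ℕ} (e : DepEdge ρ i j) : i < ρ.length ∧ j < ρ.length := by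
  rcases e with ⟨t, x, ht, hx, hl⟩ | ⟨t, x, ht, hx, hl⟩
  · have h1 := (List.getElem?_eq_some_iff.1 ht).1
    have h2 := (lastAssign_eq_coe.1 hl).1
    omega
  · have h1 := (List.getElem?_eq_some_iff.1 ht).1
    have h2 := (lastAssign_eq_coe.1 hl).1
    omega

/-- A topological numbering of an acyclic dependency graph. -/
lemma exists_lt_of_depEdge (h : ∀ i, ¬ Relation.TransGen (DepEdge ρ) i i) :
    ∃ v : ℕ → ℝ, ∀ i j, DepEdge ρ i j → v i < v j := by
  classical
  -- A position gets the number of positions from which it can be reached.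
  let S : ℕ → Finset ℕ := fun i =>
    (Finset.range ρ.length).filter fun j => Relation.TransGen (DepEdge ρ) j i
  refine ⟨fun i => ((S i).card : ℝ), fun i j e => ?_⟩
  have : S i ⊂ S j := by
    rw [Finset.ssubset_iff_of_subset]
    · refine ⟨i, ?_, ?_⟩
      · simp only [S, Finset.mem_filter, Finset.mem_range]
        exact ⟨e.lt_length.1, .single e⟩
      · simp only [S, Finset.mem_filter, Finset.mem_range]
        exact fun hh => h i hh.2
    · intro l hl
      simp only [S, Finset.mem_filter, Finset.mem_range] at hl ⊢
      exact ⟨hl.1, hl.2.tail e⟩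
  exact Nat.cast_lt.2 (Finset.card_lt_card this)

lemma DiPA.Initialized.exists_lastAssign {A : DiPA Q Γ k} (hA : A.Initialized)
    (hρ : A.IsInitRun ρ) {i : ℕ} {x : Fin k} (h : UsesAt ρ i x) :
    ∃ j : ℕ, lastAssign ρ x i = (j : WithBot ℕ) := by
  obtain ⟨t, ht, hx⟩ := h
  obtain ⟨j, hj, t', ht', hx'⟩ := hA ρ hρ i t x ht hx
  exact _root_.exists_lastAssign hj ⟨t', ht', hx'⟩

/-- A feasible run of an initialized automaton can be executed so that all constraints hold
strictly. -/
lemma DiPA.Initialized.exists_strictExec {A : DiPA Q Γ k} (hA : A.Initialized)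
    (hρ : A.IsInitRun ρ) (hf : A.Feasible ρ) (η₀ : Fin k → ℝ) : ∃ v, StrictExec ρ v η₀ := by
  obtain ⟨v, hv⟩ := exists_lt_of_depEdge hf.2
  refine ⟨v, fun i t ht => ⟨fun x hx => ?_, fun x hx => ?_⟩⟩
  · obtain ⟨j, hj⟩ := hA.exists_lastAssign hρ ⟨t, ht, Or.inl hx⟩
    rw [stored_of_lastAssign v η₀ hj]
    exact hv _ _ (Or.inr ⟨t, x, ht, hx, hj⟩)
  · obtain ⟨j, hj⟩ := hA.exists_lastAssign hρ ⟨t, ht, Or.inr hx⟩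
    rw [stored_of_lastAssign v η₀ hj]
    exact hv _ _ (Or.inl ⟨t, x, ht, hx, hj⟩)

end Executions

open MeasureTheory

/-! ### Shifting the sampled values -/

section Laplace

lemma laplaceDensity_le_shift {κ m m' z h c : ℝ} (hκ : 0 ≤ κ) (hc : κ * |h - (m' - m)| ≤ c) :
    laplaceDensity κ m z ≤ ENNReal.ofReal (Real.exp c) * laplaceDensity κ m' (z + h) := by
  unfold laplaceDensity
  rw [← ENNReal.ofReal_mul (Real.exp_nonneg c)]
  refine ENNReal.ofReal_le_ofReal ?_
  have h1 : |z + h - m'| ≤ |z - m| + |h - (m' - m)| := by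
    have : z + h - m' = (z - m) + (h - (m' - m)) := by ring
    rw [this]
    exact abs_add_le _ _
  have h2 : Real.exp (-κ * |z - m|) ≤ Real.exp c * Real.exp (-κ * |z + h - m'|) := by
    rw [← Real.exp_add]
    refine Real.exp_le_exp.2 ?_
    nlinarith [mul_le_mul_of_nonneg_left h1 hκ]
  calc κ / 2 * Real.exp (-κ * |z - m|)
      ≤ κ / 2 * (Real.exp c * Real.exp (-κ * |z + h - m'|)) :=
        mul_le_mul_of_nonneg_left h2 (by positivity)
    _ = _ := by ring

lemma measurableSet_between (l u : EReal) : MeasurableSet (between l u) :=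
  (measurableSet_lt measurable_const measurable_coe_real_ereal).inter
    (measurableSet_lt measurable_coe_real_ereal measurable_const)

/-- Translating the integration variable by `h` costs a factor `exp c`, where `c` bounds the
mismatch between `h` and the translation of the mean. -/
lemma setLIntegral_laplace_le_shift {s s' : Set ℝ} (hs : MeasurableSet s)
    (hs' : MeasurableSet s') {κ m m' h c : ℝ} {C : ℝ≥0∞} {F G : ℝ → ℝ≥0∞} (hC : C ≠ ⊤)
    (hκ : 0 ≤ κ) (hc : κ * |h - (m' - m)| ≤ c) (hss : ∀ z ∈ s, z + h ∈ s')
    (hFG : ∀ z ∈ s, F z ≤ C * G (z + h)) :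
    ∫⁻ z in s, laplaceDensity κ m z * F z ≤
      ENNReal.ofReal (Real.exp c) * C * ∫⁻ z in s', laplaceDensity κ m' z * G z := by
  rw [← lintegral_indicator hs, ← lintegral_indicator hs',
    ← lintegral_add_right_eq_self (s'.indicator fun z => laplaceDensity κ m' z * G z) h,
    ← lintegral_const_mul' _ _ (ENNReal.mul_ne_top ENNReal.ofReal_ne_top hC)]
  refine lintegral_mono fun z => ?_
  by_cases hz : z ∈ s
  · rw [Set.indicator_of_mem hz, Set.indicator_of_mem (hss z hz)]
    calc laplaceDensity κ m z * F z
        ≤ (ENNReal.ofReal (Real.exp c) * laplaceDensity κ m' (z + h)) * (C * G (z + h)) :=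
          mul_le_mul' (laplaceDensity_le_shift hκ hc) (hFG z hz)
      _ = _ := by ring
  · rw [Set.indicator_of_notMem hz]
    exact zero_le

end Laplace

section Guards

variable {Q Γ : Type*} {k : ℕ}

lemma biSup_coe_lt_iff {ι : Type*} [Finite ι] {S : Set ι} {f : ι → ℝ} {z : ℝ} :
    (⨆ x ∈ S, (f x : EReal)) < z ↔ ∀ x ∈ S, f x < z := by
  classical
  have := Fintype.ofFinite ι
  have : (⨆ x ∈ S, (f x : EReal)) = S.toFinset.sup fun x => (f x : EReal) := by
    simp [Finset.sup_eq_iSup]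
  rw [this, Finset.sup_lt_iff (EReal.bot_lt_coe z)]
  simp

lemma lt_biInf_coe_iff {ι : Type*} [Finite ι] {S : Set ι} {f : ι → ℝ} {z : ℝ} :
    (z : EReal) < (⨅ x ∈ S, (f x : EReal)) ↔ ∀ x ∈ S, z < f x := by
  classical
  have := Fintype.ofFinite ι
  have : (⨅ x ∈ S, (f x : EReal)) = S.toFinset.inf fun x => (f x : EReal) := by
    simp [Finset.inf_eq_iInf]
  rw [this, Finset.lt_inf_iff (EReal.coe_lt_top z)]
  simp

/-- The interval to which the guard of `t` confines the sampled value. -/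
def guardInterval (t : Transition Q Γ k) (η : Fin k → ℝ) : Set ℝ :=
  between (⨆ x ∈ t.smallv, (η x : EReal)) (⨅ x ∈ t.largev, (η x : EReal))

lemma mem_guardInterval {t : Transition Q Γ k} {η : Fin k → ℝ} {z : ℝ} :
    z ∈ guardInterval t η ↔ (∀ x ∈ t.smallv, η x < z) ∧ ∀ x ∈ t.largev, z < η x :=
  and_congr biSup_coe_lt_iff lt_biInf_coe_iff

/-- The values of `sample` with which the transition `t` can produce the output letter `o`. -/
def sampleSet (t : Transition Q Γ k) (o : OutLetter Γ) (η : Fin k → ℝ) : Set ℝ :=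
  guardInterval t η ∩
    {z | t.out ≠ Output.sample' → z ∈ between (outBounds o).1 (outBounds o).2}

lemma measurableSet_sampleSet (t : Transition Q Γ k) (o : OutLetter Γ) (η : Fin k → ℝ) :
    MeasurableSet (sampleSet t o η) := by
  refine (measurableSet_between _ _).inter ?_
  by_cases h : t.out = Output.sample'
  · simp [h]
  · simpa [h] using measurableSet_between _ _

open Classical in
/-- The probability that `sample'` is compatible with the output letter `o` if the transition `t`
outputs it, and `1` otherwise. -/
noncomputable def sampleProb' (t : Transition Q Γ k) (o : OutLetter Γ) (κ m : ℝ) : ℝ≥0∞ :=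
  if t.out = Output.sample' then
    ∫⁻ z in between (outBounds o).1 (outBounds o).2, laplaceDensity κ m z * 1
  else 1

/-- A uniform description of the first step of a computation. -/
lemma DiPA.prob_cons (A : DiPA Q Γ k) (ε : ℝ) (t : Transition Q Γ k)
    (ρ : List (Transition Q Γ k)) (a : Option ℝ) (α : List (Option ℝ)) (o : OutLetter Γ)
    (γ : List (OutLetter Γ)) (η : Fin k → ℝ) :
    A.prob ε (t :: ρ) (a :: α) (o :: γ) η =
      sampleProb' t o ((A.params t.src).d' * ε) ((A.params t.src).μ' + a.getD 0) *
      ∫⁻ z in sampleSet t o η,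
        laplaceDensity ((A.params t.src).d * ε) ((A.params t.src).μ + a.getD 0) z *
          A.prob ε ρ α γ (t.store η z) := by
  have h1 : t.out ≠ Output.sample' → sampleSet t o η =
      between (max (⨆ x ∈ t.smallv, (η x : EReal)) (outBounds o).1)
        (min (⨅ x ∈ t.largev, (η x : EReal)) (outBounds o).2) := by
    intro h
    ext z
    simp only [sampleSet, guardInterval, between, Set.mem_inter_iff, Set.mem_ofPred_eq, h, ne_eq,
      not_false_eq_true, true_imp_iff, max_lt_iff, lt_min_iff]
    tauto
  have h2 : t.out = Output.sample' → sampleSet t o η = guardInterval t η := by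
    intro h
    simp [sampleSet, h]
  rw [prob.eq_def]
  rcases ho : t.out with b | _ | _
  · rw [h1 (by simp [ho])]
    simp [sampleProb', ho]
  · rw [h1 (by simp [ho])]
    simp [sampleProb', ho]
  · rw [h2 ho]
    simp [sampleProb', ho, guardInterval]

lemma sampleProb'_le_shift (t : Transition Q Γ k) (o : OutLetter Γ) {κ m m' c : ℝ}
    (hκ : 0 ≤ κ) (hc0 : 0 ≤ c) (hc : t.out = Output.sample' → κ * |m' - m| ≤ c) :
    sampleProb' t o κ m ≤ ENNReal.ofReal (Real.exp c) * sampleProb' t o κ m' := by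
  unfold sampleProb'
  split_ifs with h
  · have := setLIntegral_laplace_le_shift (measurableSet_between (outBounds o).1 (outBounds o).2)
      (measurableSet_between (outBounds o).1 (outBounds o).2) (κ := κ) (m := m) (m' := m')
      (h := 0) (c := c) (C := 1) (F := fun _ => 1) (G := fun _ => 1) (by simp) hκ
      (by simpa [abs_sub_comm] using hc h) (by simp) (by simp)
    simpa using this
  · rw [mul_one, ← ENNReal.ofReal_one]
    exact ENNReal.ofReal_le_ofReal (Real.one_le_exp hc0)

end Guards

section Coupling

variable {Q Γ : Type*} {k : ℕ}

/-- The amount by which the real input at position `i` changes from `α` to `β`. -/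
def inputShift (α β : List (Option ℝ)) (i : ℕ) : ℝ :=
  (β[i]?.join).getD 0 - (α[i]?.join).getD 0

/-- The cost, in units of the privacy parameter, of shifting the value sampled by `t` by `h` when
the input changes by `δ`. -/
noncomputable def shiftCost (A : DiPA Q Γ k) (t : Transition Q Γ k) (h δ : ℝ) : ℝ :=
  (A.params t.src).d * |h - δ| +
    (match t.out with | Output.sample' => (A.params t.src).d' * |δ| | _ => 0)

/-- The shifts `h` of the sampled values preserve the dependencies of `ρ`, and do not affect the
values that `ρ` outputs. -/
structure IsShift (ρ : List (Transition Q Γ k)) (h : ℕ → ℝ) : Prop where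
  mono : ∀ i j, DepEdge ρ i j → h i ≤ h j
  out : ∀ (i : ℕ) (t : Transition Q Γ k), ρ[i]? = some t → t.out = Output.sample → h i = 0

/-- The coupling that shifts the values sampled along `ρ` by `h`. -/
lemma DiPA.prob_le_of_isShift (A : DiPA Q Γ k) {ε : ℝ} (hε : 0 ≤ ε)
    {ρ : List (Transition Q Γ k)} {α β : List (Option ℝ)} {γ : List (OutLetter Γ)}
    (hα : α.length = ρ.length) (hβ : β.length = ρ.length) (hγ : γ.length = ρ.length)
    (hm : ∀ (i : ℕ) (t : Transition Q Γ k) (o : OutLetter Γ), ρ[i]? = some t → γ[i]? = some o →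
      OutMatches t.out o)
    {h : ℕ → ℝ} (hh : IsShift ρ h) (hu : ∀ i x, UsesAt ρ i x → lastAssign ρ x i ≠ ⊥)
    {c : ℕ → ℝ} (hc : ∀ (i : ℕ) (t : Transition Q Γ k), ρ[i]? = some t →
      shiftCost A t (h i) (inputShift α β i) ≤ c i) (η : Fin k → ℝ) :
    A.prob ε ρ α γ η ≤
      ENNReal.ofReal (Real.exp ((∑ i ∈ Finset.range ρ.length, c i) * ε)) *
        A.prob ε ρ β γ η := by
  have key : ∀ m n, n + m = ρ.length → ∀ η : Fin k → ℝ,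
      A.prob ε (ρ.drop n) (α.drop n) (γ.drop n) η ≤
        ENNReal.ofReal (Real.exp ((∑ i ∈ Finset.range m, c (n + i)) * ε)) *
          A.prob ε (ρ.drop n) (β.drop n) (γ.drop n) (η + stored ρ h 0 n) := by
    intro m
    induction m with
    | zero =>
      intro n hn η
      have : ρ.drop n = [] := List.drop_eq_nil_of_le (by omega)
      simp [this, prob]
    | succ m ih =>
      intro n hn η
      have hn' : n < ρ.length := by omega
      have ht : ρ[n]? = some ρ[n] := List.getElem?_eq_getElem hn'
      rw [List.drop_eq_getElem_cons hn', List.drop_eq_getElem_cons (l := α) (by omega),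
        List.drop_eq_getElem_cons (l := β) (by omega),
        List.drop_eq_getElem_cons (l := γ) (by omega), A.prob_cons, A.prob_cons]
      set t := ρ[n] with htdef
      have hδ : inputShift α β n =
          (β[n]'(by omega)).getD 0 - (α[n]'(by omega)).getD 0 := by
        unfold inputShift
        rw [List.getElem?_eq_getElem (by omega), List.getElem?_eq_getElem (by omega)]
        rfl
      have hcn := hc n t ht
      rw [hδ] at hcn
      set a := (α[n]'(by omega)).getD 0
      set b := (β[n]'(by omega)).getD 0
      set P := A.params t.src with hP
      have hd : (0 : ℝ) ≤ P.d := by positivity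
      have hd' : (0 : ℝ) ≤ P.d' := by positivity
      -- The cost splits into the part of `sample` and the part of `sample'`.
      obtain ⟨c₁, c₂, hc12, hc1, hc2, hc20⟩ : ∃ c₁ c₂ : ℝ, c₁ + c₂ = c n ∧
          (P.d : ℝ) * |h n - (b - a)| ≤ c₁ ∧
          (t.out = Output.sample' → (P.d' : ℝ) * |b - a| ≤ c₂) ∧ 0 ≤ c₂ := by
        unfold shiftCost at hcn
        rw [← hP] at hcn
        refine ⟨(P.d : ℝ) * |h n - (b - a)|, c n - (P.d : ℝ) * |h n - (b - a)|, by ring, le_rfl,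
          ?_, ?_⟩
        · intro ho
          rw [ho] at hcn
          simp only at hcn
          linarith
        · have : 0 ≤ (P.d' : ℝ) * |b - a| := by positivity
          revert hcn
          rcases t.out with _ | _ | _ <;> simp only <;> intro hcn <;> linarith
      have hsum : (∑ i ∈ Finset.range (m + 1), c (n + i)) * ε =
          c₂ * ε + (c₁ * ε + (∑ i ∈ Finset.range m, c (n + 1 + i)) * ε) := by
        rw [Finset.sum_range_succ', add_zero, ← hc12]
        rw [Finset.sum_congr rfl fun i _ => congrArg c (show n + (i + 1) = n + 1 + i by omega)]
        ring
      rw [hsum, Real.exp_add, Real.exp_add, ENNReal.ofReal_mul (Real.exp_nonneg _),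
        ENNReal.ofReal_mul (Real.exp_nonneg _)]
      have hstep := sampleProb'_le_shift t (γ[n]'(by omega)) (κ := (P.d' : ℝ) * ε)
        (m := P.μ' + a) (m' := P.μ' + b) (c := c₂ * ε) (by positivity) (by positivity)
        (fun ho => by
          have := mul_le_mul_of_nonneg_right (hc2 ho) hε
          rw [show (P.μ' + b : ℝ) - (P.μ' + a) = b - a by ring]
          linarith)
      have hint := setLIntegral_laplace_le_shift
        (measurableSet_sampleSet t (γ[n]'(by omega)) η)
        (measurableSet_sampleSet t (γ[n]'(by omega)) (η + stored ρ h 0 n))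
        (κ := (P.d : ℝ) * ε) (m := P.μ + a) (m' := P.μ + b) (h := h n) (c := c₁ * ε)
        (C := ENNReal.ofReal (Real.exp ((∑ i ∈ Finset.range m, c (n + 1 + i)) * ε)))
        (F := fun z => A.prob ε (ρ.drop (n + 1)) (α.drop (n + 1)) (γ.drop (n + 1)) (t.store η z))
        (G := fun z => A.prob ε (ρ.drop (n + 1)) (β.drop (n + 1)) (γ.drop (n + 1))
          (t.store (η + stored ρ h 0 n) z))
        ENNReal.ofReal_ne_top (by positivity)
        (by
          have := mul_le_mul_of_nonneg_right hc1 hε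
          rw [show (P.μ + b : ℝ) - (P.μ + a) = b - a by ring]
          linarith)
        (by
          rintro z ⟨hz1, hz2⟩
          rw [mem_guardInterval] at hz1
          refine ⟨mem_guardInterval.2 ⟨fun x hx => ?_, fun x hx => ?_⟩, ?_⟩
          · obtain ⟨j, hj⟩ := (lastAssign_cases ρ x n).resolve_left
              (hu n x ⟨t, ht, Or.inl hx⟩)
            have h1 := hh.mono _ _ (Or.inr ⟨t, x, ht, hx, hj⟩)
            have h2 := hz1.1 x hx
            rw [Pi.add_apply, stored_of_lastAssign h 0 hj]
            linarith
          · obtain ⟨j, hj⟩ := (lastAssign_cases ρ x n).resolve_left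
              (hu n x ⟨t, ht, Or.inr hx⟩)
            have h1 := hh.mono _ _ (Or.inl ⟨t, x, ht, hx, hj⟩)
            have h2 := hz1.2 x hx
            rw [Pi.add_apply, stored_of_lastAssign h 0 hj]
            linarith
          · intro ho
            have hmt := hm n t _ ht (List.getElem?_eq_getElem (by omega))
            rcases hout : t.out with s | _ | _
            · rw [hout] at hmt
              rcases hγn : γ[n]'(by omega) with s' | I
              · exact ⟨EReal.bot_lt_coe _, EReal.coe_lt_top _⟩
              · rw [hγn] at hmt
                exact hmt.elim
            · rw [hh.out n t ht hout, add_zero]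
              exact hz2 ho
            · exact (ho hout).elim)
        (by
          intro z _
          have := ih (n + 1) (by omega) (t.store η z)
          have e : t.store η z + stored ρ h 0 (n + 1) =
              t.store (η + stored ρ h 0 n) (z + h n) := by
            rw [stored_succ ht]
            funext x
            simp only [Transition.store, Pi.add_apply]
            split_ifs <;> rfl
          rwa [e] at this)
      calc _ ≤ _ := mul_le_mul' hstep hint
        _ = _ := by ring
  have h0 := key ρ.length 0 (by omega) η
  simpa [stored_zero] using h0

/-- A run that can be followed with positive probability has an execution, so its dependency graph
is acyclic. -/
lemma DiPA.exists_strictExec_of_prob_ne_zero (A : DiPA Q Γ k) {ε : ℝ}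
    {ρ : List (Transition Q Γ k)} {α : List (Option ℝ)} {γ : List (OutLetter Γ)}
    (hα : α.length = ρ.length) (hγ : γ.length = ρ.length) {η : Fin k → ℝ}
    (hp : A.prob ε ρ α γ η ≠ 0) : ∃ v, StrictExec ρ v η := by
  have key : ∀ m n, n + m = ρ.length → ∀ v : ℕ → ℝ,
      A.prob ε (ρ.drop n) (α.drop n) (γ.drop n) (stored ρ v η n) ≠ 0 →
      ∃ w : ℕ → ℝ, (∀ i < n, w i = v i) ∧ ∀ i t, n ≤ i → ρ[i]? = some t →
        (∀ x ∈ t.smallv, stored ρ w η i x < w i) ∧ ∀ x ∈ t.largev, w i < stored ρ w η i x := by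
    intro m
    induction m with
    | zero =>
      intro n hn v _
      refine ⟨v, fun _ _ => rfl, fun i t hi ht => ?_⟩
      have := (List.getElem?_eq_some_iff.1 ht).1
      omega
    | succ m ih =>
      intro n hn v hne
      have hn' : n < ρ.length := by omega
      have ht : ρ[n]? = some ρ[n] := List.getElem?_eq_getElem hn'
      rw [List.drop_eq_getElem_cons hn', List.drop_eq_getElem_cons (l := α) (by omega),
        List.drop_eq_getElem_cons (l := γ) (by omega), A.prob_cons] at hne
      have hne' := right_ne_zero_of_mul hne
      obtain ⟨z, hz, hpz⟩ : ∃ z ∈ sampleSet ρ[n] (γ[n]'(by omega)) (stored ρ v η n),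
          A.prob ε (ρ.drop (n + 1)) (α.drop (n + 1)) (γ.drop (n + 1))
            (ρ[n].store (stored ρ v η n) z) ≠ 0 := by
        by_contra! hcon
        apply hne'
        rw [setLIntegral_congr_fun (g := fun _ => 0) (measurableSet_sampleSet _ _ _)]
        · simp
        · intro z hz
          simp [hcon z hz]
      have hup : ∀ i < n, Function.update v n z i = v i := fun i hi =>
        Function.update_of_ne (by omega) _ _
      have hst : stored ρ (Function.update v n z) η n = stored ρ v η n :=
        stored_congr η (fun _ _ => rfl) hup
      obtain ⟨w, hw1, hw2⟩ := ih (n + 1) (by omega) (Function.update v n z) (by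
        rwa [stored_succ ht, hst, Function.update_self])
      refine ⟨w, fun i hi => (hw1 i (by omega)).trans (hup i hi), fun i t hi hit => ?_⟩
      rcases Nat.eq_or_lt_of_le hi with rfl | hlt
      · rw [ht] at hit
        cases hit
        have e1 : stored ρ w η n = stored ρ v η n :=
          stored_congr η (fun _ _ => rfl) fun i hi => (hw1 i (by omega)).trans (hup i hi)
        have e2 : w n = z := by rw [hw1 n (by omega), Function.update_self]
        rw [e1, e2]
        exact mem_guardInterval.1 hz.1
      · exact hw2 i t hlt hit
  obtain ⟨w, -, hw⟩ := key ρ.length 0 (by omega) 0 (by simpa [stored_zero] using hp)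
  exact ⟨w, fun i t ht => hw i t (Nat.zero_le _) ht⟩

end Coupling

/-! ### Concatenation of runs -/

section Paths

variable {Q Γ : Type*} {k : ℕ}

/-- The run `ρ` leads from the state `q` to the state `q'`. -/
def DiPA.Joins (A : DiPA Q Γ k) : Q → List (Transition Q Γ k) → Q → Prop
  | q, [], q' => q = q'
  | q, t :: ρ, q' => A.IsTransition t ∧ t.src = q ∧ DiPA.Joins A t.trg ρ q'

/-- The state reached from `q` by the run `ρ`. -/
def endState (q : Q) (ρ : List (Transition Q Γ k)) : Q := ρ.foldl (fun _ t => t.trg) q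

variable {A : DiPA Q Γ k} {ρ u w : List (Transition Q Γ k)} {q q' : Q}

lemma DiPA.joins_append :
    A.Joins q (u ++ w) q' ↔ ∃ r, A.Joins q u r ∧ A.Joins r w q' := by
  induction u generalizing q with
  | nil => simp [Joins]
  | cons t u ih =>
    simp only [List.cons_append, Joins, ih]
    constructor
    · rintro ⟨h1, h2, r, h3, h4⟩
      exact ⟨r, ⟨h1, h2, h3⟩, h4⟩
    · rintro ⟨r, ⟨h1, h2, h3⟩, h4⟩
      exact ⟨h1, h2, r, h3, h4⟩

lemma DiPA.Joins.eq_endState (h : A.Joins q ρ q') : q' = endState q ρ := by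
  induction ρ generalizing q with
  | nil => exact (show q = q' from h).symm
  | cons t ρ ih => exact ih h.2.2

lemma DiPA.Joins.isRun (h : A.Joins q ρ q') : A.IsRun ρ := by
  induction ρ generalizing q with
  | nil => exact ⟨by simp, by simp⟩
  | cons t ρ ih =>
    obtain ⟨h1, h2, h3⟩ := h
    obtain ⟨r1, r2⟩ := ih h3
    refine ⟨by simpa using ⟨h1, r1⟩, ?_⟩
    cases ρ with
    | nil => simp
    | cons t' ρ => exact List.isChain_cons_cons.2 ⟨h3.2.1.symm, r2⟩

lemma DiPA.IsRun.joins (h : A.IsRun ρ) (hq : ∀ t, ρ.head? = some t → t.src = q) :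
    A.Joins q ρ (endState q ρ) := by
  induction ρ generalizing q with
  | nil => rfl
  | cons t ρ ih =>
    refine ⟨h.1 t (by simp), hq t rfl, ih ⟨fun t' ht' => h.1 t' (by simp [ht']), h.2.tail⟩ ?_⟩
    intro t' ht'
    cases ρ with
    | nil => simp at ht'
    | cons t'' ρ =>
      obtain rfl : t'' = t' := by simpa using ht'
      exact (List.isChain_cons_cons.1 h.2).1.symm

lemma DiPA.Joins.head (h : A.Joins q ρ q') : ∀ t, ρ.head? = some t → t.src = q := by
  cases ρ with
  | nil => simp
  | cons t ρ =>
    intro t' ht'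
    obtain rfl : t = t' := by simpa using ht'
    exact h.2.1

lemma DiPA.isInitRun_iff : A.IsInitRun ρ ↔ ∃ q', A.Joins A.init ρ q' :=
  ⟨fun h => ⟨_, h.1.joins h.2⟩, fun ⟨_, h⟩ => ⟨h.isRun, h.head⟩⟩

lemma endState_getLast (h : ρ ≠ []) : endState q ρ = (ρ.getLast h).trg := by
  induction ρ generalizing q with
  | nil => exact (h rfl).elim
  | cons t ρ ih =>
    cases ρ with
    | nil => rfl
    | cons t' ρ => exact ih (q := t.trg) (by simp)

lemma DiPA.Joins.isCycle (h : A.Joins q ρ q) (hne : ρ ≠ []) : A.IsCycle ρ := by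
  refine ⟨h.isRun, hne, ?_⟩
  rw [h.head _ (List.head?_eq_some_head hne), ← endState_getLast (q := q) hne]
  exact h.eq_endState

lemma DiPA.IsCycle.joins (h : A.IsCycle ρ) (hρ : A.Joins q ρ q') : q = q' := by
  obtain ⟨-, hne, h1⟩ := h
  rw [hρ.head _ (List.head?_eq_some_head hne), ← endState_getLast (q := q) hne] at h1
  rw [h1]
  exact hρ.eq_endState.symm

lemma DiPA.Joins.repeatRun (h : A.Joins q ρ q) (m : ℕ) : A.Joins q (repeatRun m ρ) q := by
  induction m with
  | zero => rfl
  | succ m ih =>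
    rw [show _root_.repeatRun (m + 1) ρ = ρ ++ _root_.repeatRun m ρ by
      simp [_root_.repeatRun, List.replicate_succ]]
    exact joins_append.2 ⟨q, h, ih⟩

lemma slice_getElem? (ρ : List (Transition Q Γ k)) (i j p : ℕ) :
    (slice ρ i j)[p]? = if i + p < j then ρ[i + p]? else none := by
  rw [slice, List.getElem?_drop, List.getElem?_take]

lemma take_append_slice (ρ : List (Transition Q Γ k)) {i j : ℕ} (h : i ≤ j) :
    ρ.take i ++ slice ρ i j = ρ.take j := by
  conv_rhs => rw [← List.take_append_drop i (ρ.take j)]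
  rw [List.take_take, min_eq_left h, slice]

lemma length_slice {ρ : List (Transition Q Γ k)} {i j : ℕ} (h : j ≤ ρ.length) :
    (slice ρ i j).length = j - i := by
  simp [slice, h]

/-- The state of a run from the initial state before position `i`. -/
def DiPA.stateAt (A : DiPA Q Γ k) (ρ : List (Transition Q Γ k)) (i : ℕ) : Q :=
  endState A.init (ρ.take i)

lemma DiPA.IsInitRun.joins_take (h : A.IsInitRun ρ) (i : ℕ) :
    A.Joins A.init (ρ.take i) (A.stateAt ρ i) := by
  obtain ⟨q', hq⟩ := isInitRun_iff.1 h
  rw [← List.take_append_drop i ρ, joins_append] at hq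
  obtain ⟨r, h1, -⟩ := hq
  rwa [h1.eq_endState] at h1

lemma DiPA.IsInitRun.take (h : A.IsInitRun ρ) (i : ℕ) : A.IsInitRun (ρ.take i) :=
  isInitRun_iff.2 ⟨_, h.joins_take i⟩

lemma DiPA.IsInitRun.joins_drop (h : A.IsInitRun ρ) (i : ℕ) :
    ∃ q', A.Joins (A.stateAt ρ i) (ρ.drop i) q' := by
  obtain ⟨q', hq⟩ := isInitRun_iff.1 h
  rw [← List.take_append_drop i ρ, joins_append] at hq
  obtain ⟨r, h1, h2⟩ := hq
  rw [h1.eq_endState] at h2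
  exact ⟨q', h2⟩

lemma DiPA.IsInitRun.joins_slice (h : A.IsInitRun ρ) {i j : ℕ} (hij : i ≤ j) :
    A.Joins (A.stateAt ρ i) (slice ρ i j) (A.stateAt ρ j) := by
  have hj := h.joins_take j
  rw [← take_append_slice ρ hij, joins_append] at hj
  obtain ⟨r, h1, h2⟩ := hj
  rwa [h1.eq_endState] at h2

end Paths

/-! ### Order types of valuations and the repetition of cycles -/

section Pumping

variable {Q Γ : Type*} {k : ℕ}

/-- Two valuations order the variables in the same way. -/
def SameOrder (η θ : Fin k → ℝ) : Prop := ∀ x y, η x ≤ η y ↔ θ x ≤ θ y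

/-- A value that is sampled for one valuation has a counterpart in the same relative position for
every valuation with the same order of the variables. -/
lemma SameOrder.exists_value {η θ : Fin k → ℝ} (h : SameOrder η θ) (s : ℝ) :
    ∃ s', (∀ x, η x ≤ s ↔ θ x ≤ s') ∧ ∀ x, s ≤ η x ↔ s' ≤ θ x := by
  classical
  by_cases hs : ∃ x, η x = s
  · obtain ⟨x, rfl⟩ := hs
    exact ⟨θ x, fun y => h y x, fun y => h x y⟩
  · push Not at hs
    obtain ⟨m, hm1, hm2⟩ := Order.exists_between_finsets
      ((Finset.univ.filter fun x => η x < s).image θ)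
      ((Finset.univ.filter fun x => s < η x).image θ) (by
        simp only [Finset.mem_image, Finset.mem_filter, Finset.mem_univ, true_and]
        rintro _ ⟨x, hx, rfl⟩ _ ⟨y, hy, rfl⟩
        have := (h y x).not.1 (not_le.2 (hx.trans hy))
        exact not_le.1 this)
    simp only [Finset.mem_image, Finset.mem_filter, Finset.mem_univ, true_and,
      forall_exists_index, and_imp, forall_apply_eq_imp_iff₂] at hm1 hm2
    refine ⟨m, fun x => ?_, fun x => ?_⟩
    · rcases lt_or_gt_of_ne (hs x) with hx | hx
      · exact iff_of_true hx.le (hm1 x hx).le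
      · exact iff_of_false (not_le.2 hx) (not_le.2 (hm2 x hx))
    · rcases lt_or_gt_of_ne (hs x) with hx | hx
      · exact iff_of_false (not_le.2 hx) (not_le.2 (hm1 x hx))
      · exact iff_of_true hx.le (hm2 x hx).le

lemma SameOrder.store {η θ : Fin k → ℝ} (h : SameOrder η θ) {s s' : ℝ}
    (h1 : ∀ x, η x ≤ s ↔ θ x ≤ s') (h2 : ∀ x, s ≤ η x ↔ s' ≤ θ x) (t : Transition Q Γ k) :
    SameOrder (t.store η s) (t.store θ s') := by
  intro x y
  unfold Transition.store
  split_ifs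
  · simp
  · exact h2 y
  · exact h1 x
  · exact h x y

/-- An execution can be prolonged by a piece of an execution that starts in a valuation with the
same order of the variables. -/
lemma StrictExec.append_slice {ρ u : List (Transition Q Γ k)} {v w : ℕ → ℝ} {η θ : Fin k → ℝ}
    (hρ : StrictExec ρ v η) (hu : StrictExec u w θ) {a : ℕ}
    (h : SameOrder (stored ρ v η a) (stored u w θ u.length)) {j : ℕ} (haj : a ≤ j)
    (hj : j ≤ ρ.length) :
    ∃ w', StrictExec (u ++ slice ρ a j) w' θ ∧
      SameOrder (stored ρ v η j)
        (stored (u ++ slice ρ a j) w' θ (u ++ slice ρ a j).length) := by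
  induction j, haj using Nat.le_induction with
  | base =>
    have : slice ρ a a = [] := List.drop_eq_nil_of_le (by simp)
    rw [this, List.append_nil]
    exact ⟨w, hu, h⟩
  | succ j haj ih =>
    obtain ⟨w', hw, hso⟩ := ih (by omega)
    have hj' : j < ρ.length := by omega
    have ht : ρ[j]? = some ρ[j] := List.getElem?_eq_getElem hj'
    have hsl : slice ρ a (j + 1) = slice ρ a j ++ [ρ[j]] := by
      unfold slice
      rw [List.take_succ_eq_append_getElem hj', List.drop_append_of_le_length (by simp; omega)]
    rw [hsl, ← List.append_assoc]
    set U := u ++ slice ρ a j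
    obtain ⟨s, hs1, hs2⟩ := hso.exists_value (v j)
    have hget : ∀ i < U.length, (U ++ [ρ[j]])[i]? = U[i]? := fun i hi =>
      List.getElem?_append_left hi
    have hlast : (U ++ [ρ[j]])[U.length]? = some ρ[j] := by simp
    have hup : ∀ i < U.length, Function.update w' U.length s i = w' i := fun i hi =>
      Function.update_of_ne (by omega) _ _
    have hst : ∀ i ≤ U.length, stored (U ++ [ρ[j]]) (Function.update w' U.length s) θ i =
        stored U w' θ i := fun i hi =>
      stored_congr θ (fun l hl => hget l (by omega)) fun l hl => hup l (by omega)
    refine ⟨Function.update w' U.length s, fun i t hit => ?_, ?_⟩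
    · have hi : i < (U ++ [ρ[j]]).length := (List.getElem?_eq_some_iff.1 hit).1
      rw [List.length_append, List.length_singleton] at hi
      rw [hst i (by omega)]
      rcases Nat.lt_succ_iff_lt_or_eq.1 hi with hlt | rfl
      · rw [hget i hlt] at hit
        rw [hup i hlt]
        exact hw i t hit
      · rw [hlast] at hit
        cases hit
        rw [Function.update_self]
        obtain ⟨g1, g2⟩ := hρ j _ ht
        refine ⟨fun x hx => ?_, fun x hx => ?_⟩
        · exact not_le.1 ((hs2 x).not.1 (not_le.2 (g1 x hx)))
        · exact not_le.1 ((hs1 x).not.1 (not_le.2 (g2 x hx)))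
    · have hU : (U ++ [ρ[j]]).length = U.length + 1 := by
        rw [List.length_append (as := U), List.length_singleton]
      rw [hU, stored_succ hlast, stored_succ ht, Function.update_self, hst _ le_rfl]
      exact hso.store hs1 hs2 _

lemma StrictExec.append_repeatRun {ρ u : List (Transition Q Γ k)} {v w : ℕ → ℝ}
    {η θ : Fin k → ℝ} (hρ : StrictExec ρ v η) {a b : ℕ} (hab : a ≤ b) (hb : b ≤ ρ.length)
    (hcyc : SameOrder (stored ρ v η b) (stored ρ v η a)) (hu : StrictExec u w θ)
    (h : SameOrder (stored ρ v η a) (stored u w θ u.length)) (m : ℕ) :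
    ∃ w', StrictExec (u ++ repeatRun m (slice ρ a b)) w' θ := by
  induction m generalizing u w with
  | zero => exact ⟨w, by simpa [repeatRun] using hu⟩
  | succ m ih =>
    rw [show repeatRun (m + 1) (slice ρ a b) = slice ρ a b ++ repeatRun m (slice ρ a b) by
      simp [repeatRun, List.replicate_succ], ← List.append_assoc]
    obtain ⟨w', h1, h2⟩ := hρ.append_slice hu h hab hb
    exact ih h1 fun x y => (hcyc x y).symm.trans (h2 x y)

lemma StrictExec.take {ρ : List (Transition Q Γ k)} {v : ℕ → ℝ} {η : Fin k → ℝ}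
    (h : StrictExec ρ v η) (b : ℕ) : StrictExec (ρ.take b) v η := by
  intro i t hit
  rw [List.getElem?_take] at hit
  split_ifs at hit with hi
  rw [stored_congr (σ := ρ) (w := v) η
    (fun l hl => by rw [List.getElem?_take, if_pos (by omega)]) fun _ _ => rfl]
  exact h i t hit

end Pumping

/-! ### Non-leaking cycles -/

section NonLeaking

variable {Q Γ : Type*} {k : ℕ} {A : DiPA Q Γ k} {ρ : List (Transition Q Γ k)} {a b : ℕ}

/-- The positions `a, …, b - 1` of `ρ` form a cycle, and no variable is both assigned and
referenced there. -/
structure DiPA.NonLeakingAt (A : DiPA Q Γ k) (ρ : List (Transition Q Γ k)) (a b : ℕ) : Prop where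
  lt : a < b
  le : b ≤ ρ.length
  state : A.stateAt ρ a = A.stateAt ρ b
  sep : ∀ x i j, a ≤ i → i < b → a ≤ j → j < b → AssignsAt ρ i x → ¬ UsesAt ρ j x

lemma DiPA.NonLeakingAt.isNonLeakingCycle (h : A.NonLeakingAt ρ a b) (hρ : A.IsInitRun ρ) :
    A.IsNonLeakingCycle (slice ρ a b) := by
  have hj := hρ.joins_slice h.lt.le
  rw [← h.state] at hj
  have hlen := length_slice (i := a) h.le
  have hlt := h.lt
  refine ⟨hj.isCycle (List.ne_nil_of_length_pos (by omega)), fun x i t hit hx => ?_⟩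
  -- Every position of the doubled cycle carries the transition of a position of the cycle.
  have hpos : ∀ (i : ℕ) (t : Transition Q Γ k), (slice ρ a b ++ slice ρ a b)[i]? = some t →
      ∃ j, a ≤ j ∧ j < b ∧ ρ[j]? = some t := by
    intro i t hit
    have : ∃ p : ℕ, (slice ρ a b)[p]? = some t := by
      rw [List.getElem?_append] at hit
      split_ifs at hit
      exacts [⟨_, hit⟩, ⟨_, hit⟩]
    obtain ⟨p, hp⟩ := this
    rw [slice_getElem?] at hp
    split_ifs at hp with hpb
    exact ⟨a + p, by omega, hpb, hp⟩
  rw [lastAssign_eq_bot]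
  rintro i' - ⟨t', hit', hx'⟩
  obtain ⟨j, h1, h2, h3⟩ := hpos i t hit
  obtain ⟨j', h1', h2', h3'⟩ := hpos i' t' hit'
  exact h.sep x j' j h1' h2' h1 h2 ⟨t', h3', hx'⟩ ⟨t, h3, hx⟩

/-- In a well-formed automaton, a piece of an execution that returns to its state and to the order
of its variables is a non-leaking cycle: it can be repeated any number of times. -/
lemma DiPA.WellFormed.nonLeakingAt (hA : A.WellFormed) (hρ : A.IsInitRun ρ) {v : ℕ → ℝ}
    {η : Fin k → ℝ} (hv : StrictExec ρ v η) (hab : a < b) (hb : b ≤ ρ.length)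
    (hs : A.stateAt ρ a = A.stateAt ρ b)
    (ho : SameOrder (stored ρ v η a) (stored ρ v η b)) : A.NonLeakingAt ρ a b := by
  refine ⟨hab, hb, hs, fun x i j hai hib haj hjb hi hj => ?_⟩
  have hlen : (ρ.take b).length = b := by simp [hb]
  have hdrop : (ρ.take b).drop a = slice ρ a b := rfl
  have hcyc := hρ.joins_slice hab.le
  rw [← hs] at hcyc
  have hget : ∀ l < b, (ρ.take b)[l]? = ρ[l]? := fun l hl => by
    rw [List.getElem?_take, if_pos hl]
  refine hA.1 (ρ.take b) ⟨hρ.take b, a, by omega, x, ?_, ?_, ?_, fun m => ?_⟩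
  · exact hcyc.isCycle (List.ne_nil_of_length_pos (by rw [length_slice hb]; omega))
  · obtain ⟨t, ht, hx⟩ := hi
    exact ⟨i, hai, t, (hget i hib).trans ht, hx⟩
  · obtain ⟨t, ht, hx⟩ := hj
    exact ⟨j, haj, t, (hget j hjb).trans ht, hx⟩
  · rw [hdrop]
    have hst : stored (ρ.take b) v η (ρ.take b).length = stored ρ v η b := by
      rw [hlen]
      exact stored_congr η hget fun _ _ => rfl
    obtain ⟨w, hw⟩ := hv.append_repeatRun hab.le hb (fun x y => (ho x y).symm) (hv.take b)
      (by rw [hst]; exact ho) m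
    refine ⟨DiPA.Joins.isRun (q := A.init) (q' := A.stateAt ρ b) (joins_append.2
      ⟨_, hρ.joins_take b, ?_⟩), hw.acyclic⟩
    rw [← hs]
    exact hcyc.repeatRun m

end NonLeaking

/-! ### Paths of dependency graphs -/

section DepPaths

variable {Q Γ : Type*} {k : ℕ} {ρ : List (Transition Q Γ k)}

lemma exists_isDepPath {i j : ℕ} (h : Relation.TransGen (DepEdge ρ) i j) :
    ∃ m κ, IsDepPath ρ m κ ∧ κ 1 = i ∧ κ m = j := by
  induction h with
  | @single c e =>
    refine ⟨2, fun r => if r = 1 then i else c, ⟨le_rfl, fun r h1 h2 => ?_⟩, by simp, by simp⟩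
    obtain rfl : r = 1 := by omega
    simpa using e
  | @tail c d _ e ih =>
    obtain ⟨m, κ, ⟨hm, hκ⟩, h1, h2⟩ := ih
    refine ⟨m + 1, fun r => if r = m + 1 then d else κ r, ⟨by omega, fun r hr1 hr2 => ?_⟩, ?_, ?_⟩
    · rcases Nat.lt_succ_iff_lt_or_eq.1 hr2 with hlt | rfl
      · simpa [show r ≠ m + 1 by omega, show r ≠ m by omega] using hκ r hr1 hlt
      · simpa [h2] using e
    · simpa [show 1 ≠ m + 1 by omega, show m ≠ 0 by omega] using h1
    · simp

/-- The value sampled at position `i` is not compared with any later sample. -/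
def Unreferenced (ρ : List (Transition Q Γ k)) (i : ℕ) : Prop :=
  ∀ j x, UsesAt ρ j x → lastAssign ρ x j ≠ (i : WithBot ℕ)

lemma Unreferenced.lt_of_depEdge_left {i j : ℕ} (h : Unreferenced ρ i) (e : DepEdge ρ i j) :
    j < i := by
  rcases e with ⟨t, x, ht, hx, hl⟩ | ⟨t, x, ht, hx, hl⟩
  · exact (lastAssign_eq_coe.1 hl).1
  · exact (h j x ⟨t, ht, Or.inl hx⟩ hl).elim

lemma Unreferenced.lt_of_depEdge_right {i j : ℕ} (h : Unreferenced ρ j) (e : DepEdge ρ i j) :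
    i < j := by
  rcases e with ⟨t, x, ht, hx, hl⟩ | ⟨t, x, ht, hx, hl⟩
  · exact (h i x ⟨t, ht, Or.inr hx⟩ hl).elim
  · exact (lastAssign_eq_coe.1 hl).1

lemma IsDepPath.first {m : ℕ} {κ : ℕ → ℕ} (h : IsDepPath ρ m κ) (hu : Unreferenced ρ (κ 1)) :
    κ 2 < κ 1 :=
  hu.lt_of_depEdge_left (h.2 1 le_rfl h.1)

lemma IsDepPath.last {m : ℕ} {κ : ℕ → ℕ} (h : IsDepPath ρ m κ) (hu : Unreferenced ρ (κ m)) :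
    κ (m - 1) < κ m := by
  have h2 := h.1
  have e := h.2 (m - 1) (by omega) (by omega)
  rw [show m - 1 + 1 = m by omega] at e
  exact hu.lt_of_depEdge_right e

end DepPaths

/-! ### Duplication of a non-leaking cycle -/

section Duplication

variable {Q Γ : Type*} {k : ℕ} {A : DiPA Q Γ k} {ρ : List (Transition Q Γ k)} {a b : ℕ}

/-- The run `ρ` with a second copy of `ρ[a:b]`. -/
def dupRun (ρ : List (Transition Q Γ k)) (a b : ℕ) : List (Transition Q Γ k) :=
  ρ.take b ++ ρ.drop a

/-- The position of `ρ` from which position `p` of `dupRun ρ a b` is copied. -/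
def dupOrig (a b p : ℕ) : ℕ := if p < b then p else p - b + a

/-- The position of `dupRun ρ a b` that corresponds to position `p` of `ρ`; for `ρ[a:b]` the
second copy is meant. -/
def dupPos (a b p : ℕ) : ℕ := if p < a then p else p + (b - a)

lemma dupRun_getElem? (hb : b ≤ ρ.length) (p : ℕ) :
    (dupRun ρ a b)[p]? = ρ[dupOrig a b p]? := by
  unfold dupRun dupOrig
  rw [List.getElem?_append, List.length_take, min_eq_left hb]
  split_ifs with h
  · rw [List.getElem?_take, if_pos h]
  · rw [List.getElem?_drop, add_comm]

lemma dupOrig_dupPos (hab : a ≤ b) (p : ℕ) : dupOrig a b (dupPos a b p) = p := by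
  unfold dupOrig dupPos
  split_ifs <;> omega

lemma assignsAt_dupRun (hb : b ≤ ρ.length) {p : ℕ} {x : Fin k} :
    AssignsAt (dupRun ρ a b) p x ↔ AssignsAt ρ (dupOrig a b p) x := by
  simp only [AssignsAt, dupRun_getElem? hb]

lemma usesAt_dupRun (hb : b ≤ ρ.length) {p : ℕ} {x : Fin k} :
    UsesAt (dupRun ρ a b) p x ↔ UsesAt ρ (dupOrig a b p) x := by
  simp only [UsesAt, dupRun_getElem? hb]

namespace DiPA.NonLeakingAt

variable (h : A.NonLeakingAt ρ a b)
include h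

lemma lastAssign_dupOrig {p i : ℕ} {x : Fin k} (hu : UsesAt (dupRun ρ a b) p x)
    (hl : lastAssign (dupRun ρ a b) x p = (i : WithBot ℕ)) :
    lastAssign ρ x (dupOrig a b p) = (dupOrig a b i : WithBot ℕ) := by
  have hab := h.lt
  rw [usesAt_dupRun h.le] at hu
  rw [lastAssign_eq_coe] at hl ⊢
  simp only [assignsAt_dupRun h.le] at hl
  obtain ⟨h1, h2, h3⟩ := hl
  have hsep := h.sep x
  have h4 : ∀ i', i' < b → i < i' → i' < p → ¬ AssignsAt ρ i' x := by
    intro i' hb' h1' h2'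
    simpa [dupOrig, hb'] using h3 i' h1' h2'
  have h5 : ∀ i', a ≤ i' → i < i' - a + b → i' - a + b < p → ¬ AssignsAt ρ i' x := by
    intro i' ha' h1' h2'
    have := h3 (i' - a + b) h1' h2'
    rwa [dupOrig, if_neg (by omega), show i' - a + b - b + a = i' by omega] at this
  refine ⟨?_, h2, fun i' hi1 hi2 ha => ?_⟩
  · by_contra hcon
    have hpb : ¬ p < b := fun hpb => hcon (by simp only [dupOrig]; split_ifs <;> omega)
    have hib : i < b := by
      by_contra hib
      exact hcon (by simp only [dupOrig]; (split_ifs; omega))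
    rw [dupOrig, if_pos hib] at h2 hcon
    rw [dupOrig, if_neg hpb] at hcon hu
    exact hsep i (p - b + a) (by omega) hib (by omega) (by omega) h2 hu
  · by_cases hpb : p < b
    · rw [dupOrig, if_pos hpb] at hi2
      rw [dupOrig, if_pos (by omega)] at hi1
      exact h4 i' (by omega) hi1 hi2 ha
    · rw [dupOrig, if_neg hpb] at hi2 hu
      by_cases hib : i < b
      · rw [dupOrig, if_pos hib] at hi1 h2
        by_cases hi'b : i' < b
        · exact h4 i' hi'b hi1 (by omega) ha
        · exact h5 i' (by omega) (by omega) (by omega) ha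
      · rw [dupOrig, if_neg hib] at hi1
        exact h5 i' (by omega) (by omega) (by omega) ha

lemma depEdge_dupOrig {p q : ℕ} (e : DepEdge (dupRun ρ a b) p q) :
    DepEdge ρ (dupOrig a b p) (dupOrig a b q) := by
  rcases e with ⟨t, x, ht, hx, hl⟩ | ⟨t, x, ht, hx, hl⟩
  · exact Or.inl ⟨t, x, by rw [← dupRun_getElem? h.le, ht], hx,
      h.lastAssign_dupOrig ⟨t, ht, Or.inr hx⟩ hl⟩
  · exact Or.inr ⟨t, x, by rw [← dupRun_getElem? h.le, ht], hx,
      h.lastAssign_dupOrig ⟨t, ht, Or.inl hx⟩ hl⟩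

lemma acyclic_dupRun (hρ : ∀ i, ¬ Relation.TransGen (DepEdge ρ) i i) (i : ℕ) :
    ¬ Relation.TransGen (DepEdge (dupRun ρ a b)) i i := fun hc =>
  hρ _ (Relation.TransGen.lift (dupOrig a b) (fun _ _ e => h.depEdge_dupOrig e) _ _ hc)

lemma unreferenced_dupRun {p : ℕ} (hp : Unreferenced ρ (dupOrig a b p)) :
    Unreferenced (dupRun ρ a b) p := fun _ x hu hl =>
  hp _ x ((usesAt_dupRun h.le).1 hu) (h.lastAssign_dupOrig hu hl)

lemma lastAssign_dupPos {p i : ℕ} {x : Fin k} (hu : UsesAt ρ p x)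
    (hl : lastAssign ρ x p = (i : WithBot ℕ)) :
    lastAssign (dupRun ρ a b) x (dupPos a b p) = (dupPos a b i : WithBot ℕ) := by
  have hab := h.lt
  rw [lastAssign_eq_coe] at hl ⊢
  simp only [assignsAt_dupRun h.le]
  obtain ⟨h1, h2, h3⟩ := hl
  refine ⟨by unfold dupPos; split_ifs <;> omega, by rwa [dupOrig_dupPos hab.le],
    fun i' hi1 hi2 ha => ?_⟩
  by_cases hpa : p < a
  · rw [dupPos, if_pos hpa] at hi2
    rw [dupPos, if_pos (by omega)] at hi1
    rw [dupOrig, if_pos (by omega)] at ha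
    exact h3 i' hi1 hi2 ha
  · rw [dupPos, if_neg hpa] at hi2
    by_cases hi'b : i' < b
    · rw [dupOrig, if_pos hi'b] at ha
      have hia : i < a := by
        by_contra hia
        rw [dupPos, if_neg hia] at hi1
        omega
      rw [dupPos, if_pos hia] at hi1
      by_cases hi'p : i' < p
      · exact h3 i' hi1 hi'p ha
      · exact h.sep x i' p (by omega) hi'b (by omega) (by omega) ha hu
    · rw [dupOrig, if_neg hi'b] at ha
      refine h3 _ ?_ (by omega) ha
      by_cases hia : i < a
      · omega
      · rw [dupPos, if_neg hia] at hi1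
        omega

lemma depEdge_dupPos {p q : ℕ} (e : DepEdge ρ p q) :
    DepEdge (dupRun ρ a b) (dupPos a b p) (dupPos a b q) := by
  have hg : ∀ p, (dupRun ρ a b)[dupPos a b p]? = ρ[p]? := fun p => by
    rw [dupRun_getElem? h.le, dupOrig_dupPos h.lt.le]
  rcases e with ⟨t, x, ht, hx, hl⟩ | ⟨t, x, ht, hx, hl⟩
  · exact Or.inl ⟨t, x, (hg p).trans ht, hx, h.lastAssign_dupPos ⟨t, ht, Or.inr hx⟩ hl⟩
  · exact Or.inr ⟨t, x, (hg q).trans ht, hx, h.lastAssign_dupPos ⟨t, ht, Or.inl hx⟩ hl⟩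

/-- In the first copy of the cycle, the constraints of the guards are the same as in `ρ`. -/
lemma lastAssign_first_copy {p i : ℕ} {x : Fin k} (hap : a ≤ p) (hpb : p < b)
    (hu : UsesAt ρ p x) (hl : lastAssign ρ x p = (i : WithBot ℕ)) :
    lastAssign (dupRun ρ a b) x p = (dupPos a b i : WithBot ℕ) := by
  have hia : i < a := by
    by_contra hia
    obtain ⟨h1, h2, -⟩ := lastAssign_eq_coe.1 hl
    exact h.sep x i p (by omega) (by omega) hap hpb h2 hu
  rw [dupPos, if_pos hia, ← hl]
  refine lastAssign_congr fun l hl => ?_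
  rw [dupRun_getElem? h.le, dupOrig, if_pos (by omega)]

lemma depEdge_first_copy_left {p q : ℕ} (hap : a ≤ p) (hpb : p < b) (hp : Unreferenced ρ p)
    (e : DepEdge ρ p q) : DepEdge (dupRun ρ a b) p (dupPos a b q) := by
  rcases e with ⟨t, x, ht, hx, hl⟩ | ⟨t, x, ht, hx, hl⟩
  · refine Or.inl ⟨t, x, ?_, hx, h.lastAssign_first_copy hap hpb ⟨t, ht, Or.inr hx⟩ hl⟩
    rw [dupRun_getElem? h.le, dupOrig, if_pos hpb, ht]
  · exact (hp q x ⟨t, ht, Or.inl hx⟩ hl).elim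

lemma depEdge_first_copy_right {p q : ℕ} (hap : a ≤ p) (hpb : p < b) (hp : Unreferenced ρ p)
    (e : DepEdge ρ q p) : DepEdge (dupRun ρ a b) (dupPos a b q) p := by
  rcases e with ⟨t, x, ht, hx, hl⟩ | ⟨t, x, ht, hx, hl⟩
  · exact (hp q x ⟨t, ht, Or.inr hx⟩ hl).elim
  · refine Or.inr ⟨t, x, ?_, hx, h.lastAssign_first_copy hap hpb ⟨t, ht, Or.inl hx⟩ hl⟩
    rw [dupRun_getElem? h.le, dupOrig, if_pos hpb, ht]

lemma isInitRun_dupRun (hρ : A.IsInitRun ρ) : A.IsInitRun (dupRun ρ a b) := by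
  obtain ⟨q', hq⟩ := hρ.joins_drop a
  rw [h.state] at hq
  exact isInitRun_iff.2 ⟨q', joins_append.2 ⟨_, hρ.joins_take b, hq⟩⟩

lemma slice_dupRun_first : slice (dupRun ρ a b) a b = slice ρ a b := by
  refine List.ext_getElem? fun p => ?_
  rw [slice_getElem?, slice_getElem?, dupRun_getElem? h.le]
  split_ifs with hp
  · rw [dupOrig, if_pos hp]
  · rfl

lemma slice_dupRun {i j : ℕ} (hi : a ≤ i) :
    slice (dupRun ρ a b) (i + (b - a)) (j + (b - a)) = slice ρ i j := by
  have hab := h.lt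
  refine List.ext_getElem? fun p => ?_
  rw [slice_getElem?, slice_getElem?, dupRun_getElem? h.le]
  have e : dupOrig a b (i + (b - a) + p) = i + p := by
    rw [dupOrig, if_neg (by omega)]
    omega
  rw [e]
  by_cases hp : i + p < j
  · rw [if_pos hp, if_pos (by omega)]
  · rw [if_neg hp, if_neg (by omega)]

lemma length_dupRun : (dupRun ρ a b).length = ρ.length + (b - a) := by
  have := h.lt
  have := h.le
  simp only [dupRun, List.length_append, List.length_take, List.length_drop]
  omega

end DiPA.NonLeakingAt

end Duplication

/-! ### Positions at which a change of the input is free -/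

section FreePositions

variable {Q Γ : Type*} {k : ℕ} {A : DiPA Q Γ k} {ρ : List (Transition Q Γ k)}

/-- Position `i` lies in a non-leaking cycle and no later guard refers to its sample. The value
sampled at such a position can follow the change of the input at no cost. -/
def DiPA.FreeAt (A : DiPA Q Γ k) (ρ : List (Transition Q Γ k)) (i : ℕ) : Prop :=
  (∃ a b, a ≤ i ∧ i < b ∧ A.NonLeakingAt ρ a b) ∧ Unreferenced ρ i

/-- There is no path between free positions: after the cycle of one of them has been duplicated,
it would be a leaking pair. -/
lemma DiPA.WellFormed.not_path_of_freeAt (hA : A.WellFormed) (hρ : A.IsInitRun ρ)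
    (hf : A.Feasible ρ) {p q : ℕ} (hp : A.FreeAt ρ p) (hq : A.FreeAt ρ q) :
    ¬ Relation.TransGen (DepEdge ρ) p q := by
  intro hpath
  obtain ⟨⟨a₁, b₁, hp1, hp2, hc1⟩, hup⟩ := hp
  obtain ⟨⟨a₂, b₂, hq1, hq2, hc2⟩, huq⟩ := hq
  have hlt1 := hc1.lt
  have hlt2 := hc2.lt
  have hle1 := hc1.le
  have hle2 := hc2.le
  rcases le_or_gt a₁ a₂ with h12 | h12
  · -- The path leaves the first copy of the cycle of `p`.
    have hpath' : Relation.TransGen (DepEdge (dupRun ρ a₁ b₁)) p (dupPos a₁ b₁ q) := by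
      obtain ⟨c, e, hr⟩ := Relation.TransGen.head'_iff.1 hpath
      exact .head' (hc1.depEdge_first_copy_left hp1 hp2 hup e)
        (Relation.ReflTransGen.lift (dupPos a₁ b₁) (fun _ _ e => hc1.depEdge_dupPos e) _ _ hr)
    have hupos : Unreferenced (dupRun ρ a₁ b₁) p :=
      hc1.unreferenced_dupRun (by rwa [dupOrig, if_pos hp2])
    have huqos : Unreferenced (dupRun ρ a₁ b₁) (dupPos a₁ b₁ q) :=
      hc1.unreferenced_dupRun (by rwa [dupOrig_dupPos hlt1.le])
    obtain ⟨m, κ, hκ, h1, hm⟩ := exists_isDepPath hpath'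
    have hqpos : dupPos a₁ b₁ q = q + (b₁ - a₁) := if_neg (by omega)
    refine hA.2.1 (dupRun ρ a₁ b₁) ⟨hc1.isInitRun_dupRun hρ,
      ⟨(hc1.isInitRun_dupRun hρ).1, hc1.acyclic_dupRun hf.2⟩, a₁, b₁, a₂ + (b₁ - a₁),
      b₂ + (b₁ - a₁), hlt1, ?_, by omega, ?_, ?_, ?_, Or.inl (by omega), m, κ, hκ, ?_, ?_,
      hκ.first (by rwa [h1]), hκ.last (by rwa [hm])⟩
    · rw [hc1.length_dupRun]
      omega
    · rw [hc1.length_dupRun]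
      omega
    · rw [hc1.slice_dupRun_first]
      exact hc1.isNonLeakingCycle hρ
    · rw [hc1.slice_dupRun h12]
      exact hc2.isNonLeakingCycle hρ
    · omega
    · omega
  · -- The path arrives in the first copy of the cycle of `q`.
    have hpath' : Relation.TransGen (DepEdge (dupRun ρ a₂ b₂)) (dupPos a₂ b₂ p) q := by
      obtain ⟨c, hr, e⟩ := Relation.TransGen.tail'_iff.1 hpath
      exact .tail' (Relation.ReflTransGen.lift (dupPos a₂ b₂)
        (fun _ _ e => hc2.depEdge_dupPos e) _ _ hr) (hc2.depEdge_first_copy_right hq1 hq2 huq e)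
    have huqos : Unreferenced (dupRun ρ a₂ b₂) q :=
      hc2.unreferenced_dupRun (by rwa [dupOrig, if_pos hq2])
    have hupos : Unreferenced (dupRun ρ a₂ b₂) (dupPos a₂ b₂ p) :=
      hc2.unreferenced_dupRun (by rwa [dupOrig_dupPos hlt2.le])
    obtain ⟨m, κ, hκ, h1, hm⟩ := exists_isDepPath hpath'
    have hppos : dupPos a₂ b₂ p = p + (b₂ - a₂) := if_neg (by omega)
    refine hA.2.1 (dupRun ρ a₂ b₂) ⟨hc2.isInitRun_dupRun hρ,
      ⟨(hc2.isInitRun_dupRun hρ).1, hc2.acyclic_dupRun hf.2⟩, a₁ + (b₂ - a₂), b₁ + (b₂ - a₂),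
      a₂, b₂, by omega, ?_, hlt2, ?_, ?_, ?_, Or.inr (by omega), m, κ, hκ, ?_, ?_,
      hκ.first (by rwa [h1]), hκ.last (by rwa [hm])⟩
    · rw [hc2.length_dupRun]
      omega
    · rw [hc2.length_dupRun]
      omega
    · rw [hc2.slice_dupRun h12.le]
      exact hc1.isNonLeakingCycle hρ
    · rw [hc2.slice_dupRun_first]
      exact hc2.isNonLeakingCycle hρ
    · omega
    · omega

lemma DiPA.Feasible.take (hρ : A.IsInitRun ρ) (hf : A.Feasible ρ) (b : ℕ) :
    A.Feasible (ρ.take b) := by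
  obtain ⟨v, hv⟩ := exists_lt_of_depEdge hf.2
  refine ⟨(hρ.take b).1, fun i hc => hf.2 i ?_⟩
  refine Relation.TransGen.lift id (fun p q e => ?_) _ _ hc
  have hget : ∀ {i : ℕ} {t : Transition Q Γ k}, (ρ.take b)[i]? = some t →
      i < b ∧ ρ[i]? = some t := by
    intro i t hit
    rw [List.getElem?_take] at hit
    split_ifs at hit with hi
    exact ⟨hi, hit⟩
  have hlast : ∀ i x, i < b → lastAssign (ρ.take b) x i = lastAssign ρ x i := fun i x hi =>
    lastAssign_congr fun l hl => by rw [List.getElem?_take, if_pos (by omega)]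
  rcases e with ⟨t, x, ht, hx, hl⟩ | ⟨t, x, ht, hx, hl⟩
  · rw [hlast _ _ (hget ht).1] at hl
    exact Or.inl ⟨t, x, (hget ht).2, hx, hl⟩
  · rw [hlast _ _ (hget ht).1] at hl
    exact Or.inr ⟨t, x, (hget ht).2, hx, hl⟩

/-- A free position with a real output is not an input position: it would give a disclosing
cycle. -/
lemma DiPA.WellFormed.isInput_eq_false (hA : A.WellFormed) (hρ : A.IsInitRun ρ)
    (hf : A.Feasible ρ) {i : ℕ} (hi : A.FreeAt ρ i) {t : Transition Q Γ k} (ht : ρ[i]? = some t)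
    (ho : t.out = Output.sample ∨ t.out = Output.sample') : A.isInput t.src = false := by
  obtain ⟨⟨a, b, hai, hib, hc⟩, -⟩ := hi
  by_contra hin
  refine hA.2.2.1 (ρ.take b) ⟨hρ.take b, hf.take hρ b, a, i, hai, ?_, hc.isNonLeakingCycle hρ, t,
    ?_, by simpa using hin, ho⟩
  · have := hc.le
    simpa using ⟨hib, by omega⟩
  · rw [List.getElem?_take, if_pos hib, ht]

open Classical in
/-- The shift of the value sampled at position `i` when the inputs change by `δ`: free positions
follow the input, and the others make way for them. -/
noncomputable def DiPA.shift (A : DiPA Q Γ k) (ρ : List (Transition Q Γ k)) (δ : ℕ → ℝ) (i : ℕ) :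
    ℝ :=
  if A.FreeAt ρ i then δ i
  else if ∃ l, A.FreeAt ρ l ∧ Relation.TransGen (DepEdge ρ) l i then 1
  else if ∃ l, A.FreeAt ρ l ∧ Relation.TransGen (DepEdge ρ) i l then -1
  else 0

lemma DiPA.abs_shift_le {δ : ℕ → ℝ} (hδ : ∀ i, |δ i| ≤ 1) (i : ℕ) : |A.shift ρ δ i| ≤ 1 := by
  unfold shift
  split_ifs
  · exact hδ i
  all_goals simp

/-- Monotonicity holds since no path joins two free positions; the shift vanishes at positions that
output `sample` since there are no privacy violating paths and no disclosing cycles. -/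
lemma DiPA.WellFormed.isShift (hA : A.WellFormed) (hρ : A.IsInitRun ρ) (hf : A.Feasible ρ)
    {δ : ℕ → ℝ} (hδ : ∀ i, |δ i| ≤ 1)
    (hδ0 : ∀ (i : ℕ) (t : Transition Q Γ k), ρ[i]? = some t → A.isInput t.src = false → δ i = 0) :
    IsShift ρ (A.shift ρ δ) := by
  constructor
  · intro i j e
    have hi := abs_le.1 (A.abs_shift_le (ρ := ρ) hδ i)
    have hj := abs_le.1 (A.abs_shift_le (ρ := ρ) hδ j)
    by_cases fi : A.FreeAt ρ i
    · have fj : ¬ A.FreeAt ρ j := fun fj => hA.not_path_of_freeAt hρ hf fi fj (.single e)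
      rw [show A.shift ρ δ j = 1 by
        unfold shift
        rw [if_neg fj, if_pos ⟨i, fi, .single e⟩]]
      exact hi.2
    by_cases fj : A.FreeAt ρ j
    · have : ¬ ∃ l, A.FreeAt ρ l ∧ Relation.TransGen (DepEdge ρ) l i := by
        rintro ⟨l, fl, hl⟩
        exact hA.not_path_of_freeAt hρ hf fl fj (hl.tail e)
      rw [show A.shift ρ δ i = -1 by
        unfold shift
        rw [if_neg fi, if_neg this, if_pos ⟨j, fj, .single e⟩]]
      exact hj.1
    by_cases pi : ∃ l, A.FreeAt ρ l ∧ Relation.TransGen (DepEdge ρ) l i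
    · obtain ⟨l, fl, hl⟩ := pi
      rw [show A.shift ρ δ j = 1 by
        unfold shift
        rw [if_neg fj, if_pos ⟨l, fl, hl.tail e⟩]]
      exact hi.2
    by_cases mj : ∃ l, A.FreeAt ρ l ∧ Relation.TransGen (DepEdge ρ) j l
    · obtain ⟨l, fl, hl⟩ := mj
      rw [show A.shift ρ δ i = -1 by
        unfold shift
        rw [if_neg fi, if_neg pi, if_pos ⟨l, fl, hl.head e⟩]]
      exact hj.1
    · unfold shift
      rw [if_neg fi, if_neg pi, if_neg fj, if_neg mj]
      split_ifs <;> norm_num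
  · intro i t ht ho
    by_cases fi : A.FreeAt ρ i
    · unfold shift
      rw [if_pos fi]
      exact hδ0 i t ht (hA.isInput_eq_false hρ hf fi ht (Or.inl ho))
    have hplus : ¬ ∃ l, A.FreeAt ρ l ∧ Relation.TransGen (DepEdge ρ) l i := by
      rintro ⟨l, ⟨⟨a, b, hal, hlb, hc⟩, hu⟩, hl⟩
      obtain ⟨m, κ, hκ, h1, hm⟩ := exists_isDepPath hl
      exact hA.2.2.2 ρ ⟨hρ, hf, a, b, hc.lt.le, hc.le, hc.isNonLeakingCycle hρ, m, κ, hκ,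
        Or.inr ⟨by omega, by omega, hκ.first (by rwa [h1]), t, by rw [hm, ht], ho⟩⟩
    have hminus : ¬ ∃ l, A.FreeAt ρ l ∧ Relation.TransGen (DepEdge ρ) i l := by
      rintro ⟨l, ⟨⟨a, b, hal, hlb, hc⟩, hu⟩, hl⟩
      obtain ⟨m, κ, hκ, h1, hm⟩ := exists_isDepPath hl
      exact hA.2.2.2 ρ ⟨hρ, hf, a, b, hc.lt.le, hc.le, hc.isNonLeakingCycle hρ, m, κ, hκ,
        Or.inl ⟨⟨t, by rw [h1, ht], ho⟩, hκ.last (by rwa [hm]), by omega, by omega⟩⟩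
    unfold shift
    rw [if_neg fi, if_neg hplus, if_neg hminus]

/-- Only positions that are not free cost anything. -/
lemma DiPA.WellFormed.shiftCost_le (hA : A.WellFormed) (hρ : A.IsInitRun ρ) (hf : A.Feasible ρ)
    {δ : ℕ → ℝ} (hδ : ∀ i, |δ i| ≤ 1)
    (hδ0 : ∀ (i : ℕ) (t : Transition Q Γ k), ρ[i]? = some t → A.isInput t.src = false → δ i = 0)
    {i : ℕ} {t : Transition Q Γ k} (ht : ρ[i]? = some t) {W : ℝ}
    (hW : ((A.params t.src).d : ℝ) + (A.params t.src).d' ≤ W) [Decidable (A.FreeAt ρ i)] :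
    shiftCost A t (A.shift ρ δ i) (δ i) ≤ if A.FreeAt ρ i then 0 else 2 * W := by
  have hd : (0 : ℝ) ≤ (A.params t.src).d := by positivity
  have hd' : (0 : ℝ) ≤ (A.params t.src).d' := by positivity
  unfold shiftCost
  split_ifs with fi
  · have hs : A.shift ρ δ i = δ i := by
      unfold shift
      rw [if_pos fi]
    rw [hs, sub_self, abs_zero, mul_zero, zero_add]
    rcases ho : t.out with _ | _ | _
    · exact le_rfl
    · exact le_rfl
    · simp [hδ0 i t ht (hA.isInput_eq_false hρ hf fi ht (Or.inr ho))]
  · have h1 : |A.shift ρ δ i - δ i| ≤ 2 := by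
      have h1 := abs_sub (A.shift ρ δ i) (δ i)
      have h2 := A.abs_shift_le (ρ := ρ) hδ i
      have h3 := hδ i
      linarith
    have h2 := mul_le_mul_of_nonneg_left h1 hd
    have h3 := mul_le_mul_of_nonneg_left (hδ i) hd'
    rcases t.out with _ | _ | _ <;> simp only <;> linarith

end FreePositions

/-! ### The number of positions that are not free -/

section Counting

variable {Q Γ : Type*} {k : ℕ} {A : DiPA Q Γ k} {ρ : List (Transition Q Γ k)}

/-- The configuration of an execution before position `i`: the state and the order of the stored
values. -/
noncomputable def DiPA.config (A : DiPA Q Γ k) (ρ : List (Transition Q Γ k)) (v : ℕ → ℝ)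
    (i : ℕ) : Q × (Fin k → Fin k → Prop) :=
  (A.stateAt ρ i, fun x y => stored ρ v 0 i x ≤ stored ρ v 0 i y)

lemma DiPA.WellFormed.nonLeakingAt_of_config_eq (hA : A.WellFormed) (hρ : A.IsInitRun ρ)
    {v : ℕ → ℝ} (hv : StrictExec ρ v 0) {a b : ℕ} (hab : a < b) (hb : b ≤ ρ.length)
    (h : A.config ρ v a = A.config ρ v b) : A.NonLeakingAt ρ a b := by
  obtain ⟨h1, h2⟩ := Prod.mk.inj h
  exact hA.nonLeakingAt hρ hv hab hb h1 fun x y => iff_of_eq (congrFun (congrFun h2 x) y)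

open Classical in
/-- Positions outside of all non-leaking cycles have different configurations, and so have the
successors of positions at which a given variable is assigned and referenced later. -/
lemma DiPA.WellFormed.card_not_freeAt_le [Finite Q] (hA : A.WellFormed) (hI : A.Initialized)
    (hρ : A.IsInitRun ρ) (hf : A.Feasible ρ) :
    ((Finset.range ρ.length).filter fun i => ¬ A.FreeAt ρ i).card ≤
      (k + 1) * (Nat.card Q * 2 ^ (k * k)) := by
  obtain ⟨v, hv⟩ := hI.exists_strictExec hρ hf 0
  have := Fintype.ofFinite Q
  have hcard : Fintype.card (Q × (Fin k → Fin k → Prop)) = Nat.card Q * 2 ^ (k * k) := by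
    rw [Fintype.card_prod, Fintype.card_fun, Fintype.card_fun, Fintype.card_prop,
      Fintype.card_fin, ← pow_mul, Nat.card_eq_fintype_card]
  rw [← hcard]
  set N := Fintype.card (Q × (Fin k → Fin k → Prop))
  let E : Finset ℕ := (Finset.range ρ.length).filter fun i =>
    ¬ ∃ a b, a ≤ i ∧ i < b ∧ A.NonLeakingAt ρ a b
  let R : Fin k → Finset ℕ := fun x => (Finset.range ρ.length).filter fun i =>
    ∃ j, UsesAt ρ j x ∧ lastAssign ρ x j = (i : WithBot ℕ)
  have hsub : ((Finset.range ρ.length).filter fun i => ¬ A.FreeAt ρ i) ⊆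
      E ∪ Finset.univ.biUnion R := by
    intro i hi
    simp only [Finset.mem_filter, FreeAt, Unreferenced, not_and_or, not_forall, ne_eq,
      not_not] at hi
    rcases hi.2 with h | ⟨j, x, hu, hl⟩
    · exact Finset.mem_union_left _ (Finset.mem_filter.2 ⟨hi.1, h⟩)
    · exact Finset.mem_union_right _ (Finset.mem_biUnion.2
        ⟨x, Finset.mem_univ x, Finset.mem_filter.2 ⟨hi.1, j, hu, hl⟩⟩)
  have hE : E.card ≤ N := by
    refine (Finset.card_le_card_of_injOn (t := Finset.univ) (A.config ρ v)
      (fun _ _ => Finset.mem_univ _) ?_).trans_eq Finset.card_univ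
    have key : ∀ i ∈ E, ∀ j ∈ E, i < j → A.config ρ v i ≠ A.config ρ v j := by
      intro i hi j hj hij he
      have hj' := Finset.mem_range.1 (Finset.mem_filter.1 hj).1
      exact (Finset.mem_filter.1 hi).2
        ⟨i, j, le_rfl, hij, hA.nonLeakingAt_of_config_eq hρ hv hij hj'.le he⟩
    intro i hi j hj he
    rcases lt_trichotomy i j with h | h | h
    exacts [(key i hi j hj h he).elim, h, (key j hj i hi h he.symm).elim]
  have hR : ∀ x, (R x).card ≤ N := by
    intro x
    refine (Finset.card_le_card_of_injOn (t := Finset.univ) (fun i => A.config ρ v (i + 1))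
      (fun _ _ => Finset.mem_univ _) ?_).trans_eq Finset.card_univ
    have key : ∀ i ∈ R x, ∀ j ∈ R x, i < j →
        A.config ρ v (i + 1) ≠ A.config ρ v (j + 1) := by
      intro i hi j hj hij he
      have hj' := Finset.mem_range.1 (Finset.mem_filter.1 hj).1
      obtain ⟨l, hu, hl⟩ := (Finset.mem_filter.1 hi).2
      obtain ⟨l', -, hl'⟩ := (Finset.mem_filter.1 hj).2
      obtain ⟨h1, -, h3⟩ := lastAssign_eq_coe.1 hl
      have hja := (lastAssign_eq_coe.1 hl').2.1
      -- The reference at `l` precedes the next assignment of `x`.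
      have hlj : l ≤ j := by
        by_contra hcon
        exact h3 j hij (by omega) hja
      exact (hA.nonLeakingAt_of_config_eq hρ hv (by omega) hj' he).sep x j l (by omega) (by omega)
        (by omega) (by omega) hja hu
    intro i hi j hj he
    rcases lt_trichotomy i j with h | h | h
    exacts [(key i hi j hj h he).elim, h, (key j hj i hi h he.symm).elim]
  calc _ ≤ (E ∪ Finset.univ.biUnion R).card := Finset.card_le_card hsub
    _ ≤ E.card + (Finset.univ.biUnion R).card := Finset.card_union_le _ _
    _ ≤ N + ∑ x, (R x).card := add_le_add hE Finset.card_biUnion_le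
    _ ≤ N + ∑ _x : Fin k, N := by gcongr with x; exact hR x
    _ = (k + 1) * N := by
      simp
      ring

end Counting

/-! ### Differential privacy of well-formed automata -/

section Privacy

variable {Q Γ : Type*} {k : ℕ} {A : DiPA Q Γ k}

lemma Adjacent.getElem? {α β : List (Option ℝ)} (h : Adjacent α β) (i : ℕ) :
    (α[i]? = none ∧ β[i]? = none) ∨ (α[i]? = some none ∧ β[i]? = some none) ∨
      ∃ a b, α[i]? = some (some a) ∧ β[i]? = some (some b) ∧ |a - b| ≤ 1 := by
  obtain ⟨hl, h⟩ := List.forall₂_iff_get.1 h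
  by_cases hi : i < α.length
  · have := h i hi (by omega)
    simp only [List.get_eq_getElem] at this
    rw [List.getElem?_eq_getElem hi, List.getElem?_eq_getElem (by omega)]
    revert this
    rcases α[i] with _ | a <;> rcases β[i]'(by omega) with _ | b <;>
      simp [AdjacentLetter]
  · exact Or.inl ⟨List.getElem?_eq_none (by omega), List.getElem?_eq_none (by omega)⟩

lemma Adjacent.symm {α β : List (Option ℝ)} (h : Adjacent α β) : Adjacent β α := by
  refine List.Forall₂.flip (List.Forall₂.imp (fun a b hab => ?_) h)
  rcases a with _ | a <;> rcases b with _ | b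
  · trivial
  · exact hab
  · exact hab
  · exact (abs_sub_comm b a).trans_le hab

lemma DiPA.runs_subset_of_adjacent {α β : List (Option ℝ)} (h : Adjacent α β)
    (γ : List (OutLetter Γ)) : A.runs α γ ⊆ A.runs β γ := by
  rintro ρ ⟨h1, h2, h3, h4, h5, h6⟩
  refine ⟨h1, h2, h3.trans h.length_eq, h4, fun i t b ht hb => ?_, h6⟩
  rcases h.getElem? i with ⟨-, e⟩ | ⟨e1, e2⟩ | ⟨a, b', e1, e2, -⟩
  · rw [e] at hb
    cases hb
  · rw [e2] at hb
    cases hb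
    exact h5 i t _ ht e1
  · rw [e2] at hb
    cases hb
    have := h5 i t _ ht e1
    simpa using this

/-- The privacy loss is bounded by the number of positions that are not free, times the largest
loss of a single transition. -/
theorem DiPA.WellFormed.differentiallyPrivate [Finite Q] (hA : A.WellFormed) (hI : A.Initialized)
    {W D ε : ℝ} (hW0 : 0 ≤ W)
    (hW : ∀ t, A.IsTransition t → ((A.params t.src).d : ℝ) + (A.params t.src).d' ≤ W)
    (hD : ((k + 1) * (Nat.card Q * 2 ^ (k * k)) : ℕ) * (2 * W) ≤ D) (hε : 0 < ε) :
    A.DifferentiallyPrivate D ε := by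
  classical
  intro α β γ η hadj
  rw [(A.runs_subset_of_adjacent hadj γ).antisymm (A.runs_subset_of_adjacent hadj.symm γ),
    ← ENNReal.tsum_mul_left]
  refine ENNReal.tsum_le_tsum ?_
  rintro ⟨ρ, hρ, h2, hβ, hγ, h5, h6⟩
  have hα : ρ.length = α.length := hβ.trans hadj.length_eq.symm
  by_cases hp : A.prob ε ρ α γ η = 0
  · rw [hp]
    exact zero_le
  obtain ⟨v, hv⟩ := A.exists_strictExec_of_prob_ne_zero hα.symm hγ.symm hp
  have hf : A.Feasible ρ := ⟨h2, hv.acyclic⟩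
  have hδ : ∀ i, |inputShift α β i| ≤ 1 := by
    intro i
    unfold inputShift
    rcases hadj.getElem? i with ⟨e1, e2⟩ | ⟨e1, e2⟩ | ⟨a, b, e1, e2, hab⟩
    · simp [e1, e2]
    · simp [e1, e2]
    · simpa [e1, e2, abs_sub_comm] using hab
  have hδ0 : ∀ (i : ℕ) (t : Transition Q Γ k), ρ[i]? = some t → A.isInput t.src = false →
      inputShift α β i = 0 := by
    intro i t ht hin
    unfold inputShift
    rcases hadj.getElem? i with ⟨e1, e2⟩ | ⟨e1, e2⟩ | ⟨a, b, e1, e2, hab⟩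
    · simp [e1, e2]
    · simp [e1, e2]
    · have := (h5 i t _ ht e2).2 hin
      cases this
  refine (A.prob_le_of_isShift hε.le hα.symm hβ.symm hγ.symm h6
    (hA.isShift hρ hf hδ hδ0) (fun i x hu => ?_)
    (c := fun i => if A.FreeAt ρ i then 0 else 2 * W) (fun i t ht => ?_) η).trans ?_
  · obtain ⟨j, hj⟩ := hI.exists_lastAssign hρ hu
    rw [hj]
    exact WithBot.coe_ne_bot
  · exact hA.shiftCost_le hρ hf hδ hδ0 ht (hW t (h2.1 t (List.mem_of_getElem? ht)))
  · refine mul_le_mul' (ENNReal.ofReal_le_ofReal (Real.exp_le_exp.2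
      (mul_le_mul_of_nonneg_right (le_trans ?_ hD) hε.le))) le_rfl
    have hsum : ∑ i ∈ Finset.range ρ.length, (if A.FreeAt ρ i then 0 else 2 * W) =
        ((Finset.range ρ.length).filter fun i => ¬ A.FreeAt ρ i).card * (2 * W) := by
      rw [← nsmul_eq_mul, ← Finset.sum_const, Finset.sum_filter]
      exact Finset.sum_congr rfl fun i _ => by split_ifs <;> simp_all
    rw [hsum]
    exact mul_le_mul_of_nonneg_right (Nat.cast_le.2 (hA.card_not_freeAt_le hI hρ hf))
      (by positivity)

end Privacy

/-! ### A machine that computes an iterated power of two -/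

namespace PowerMachine

open Turing

/-- The stacks of the machine: for the input, for the output, and for intermediate results. -/
inductive Stack
  | inp
  | out
  | tmp
  deriving DecidableEq

instance : Fintype Stack := ⟨{.inp, .out, .tmp}, fun x => by cases x <;> simp⟩

/-- The labels of the program. -/
inductive Label
  | start
  | loop
  | double
  | back
  deriving DecidableEq

instance : Fintype Label := ⟨{.start, .loop, .double, .back}, fun x => by cases x <;> simp⟩

open Stack Label TM2.Stmt

/-- The program. The block of letters `false` on top of the output stack is doubled for each letter
of the input: `double` moves the block to the stack `tmp`, and `back` returns two letters for each
letter that was moved. The internal state holds the letter that was read last. -/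
def program : Label → TM2.Stmt (fun _ : Stack => Option Bool) Label (Option (Option Bool))
  | start => push out (fun _ => none) <| push out (fun _ => some true) <|
      push out (fun _ => none) <| push out (fun _ => some true) <|
      push out (fun _ => some false) <| goto fun _ => loop
  | loop => pop inp (fun _ s => s) <| branch (fun s => s.isSome) (goto fun _ => double) <|
      push out (fun _ => none) halt
  | double => pop out (fun _ s => s) <| branch (fun s => s == some (some false))
      (push tmp (fun _ => some false) <| goto fun _ => double)
      (push out (fun _ => some true) <| goto fun _ => back)
  | back => pop tmp (fun _ s => s) <| branch (fun s => s.isSome)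
      (push out (fun _ => some false) <| push out (fun _ => some false) <| goto fun _ => back)
      (goto fun _ => loop)

/-- The machine with the above program. -/
def machine : FinTM2 where
  K := Stack
  k₀ := inp
  k₁ := out
  Γ := fun _ => Option Bool
  Λ := Label
  main := start
  σ := Option (Option Bool)
  initialState := none
  Γk₀Fin := inferInstanceAs (Fintype (Option Bool))
  m := program

/-- The configuration with the given contents of the stacks. -/
def cfg (l : Option Label) (s : Option (Option Bool)) (a b c : List (Option Bool)) :
    machine.Cfg where
  l := l
  var := s
  stk := fun
    | inp => a
    | out => b
    | tmp => c

/-- The machine gets from `c` to `c'` in `n` steps. -/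
def Reaches (n : ℕ) (c c' : machine.Cfg) : Prop :=
  (flip bind machine.step)^[n] (some c) = some c'

lemma Reaches.trans {m n : ℕ} {c c' c'' : machine.Cfg} (h : Reaches m c c')
    (h' : Reaches n c' c'') : Reaches (n + m) c c'' := by
  unfold Reaches at *
  rw [Function.iterate_add_apply, h, h']

lemma reaches_one {c c' : machine.Cfg} (h : machine.step c = some c') : Reaches 1 c c' := h

lemma cfg_ext {c : machine.Cfg} {l : Option Label} {s : Option (Option Bool)}
    {x y z : List (Option Bool)} (h1 : c.l = l) (h2 : c.var = s) (h3 : c.stk inp = x)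
    (h4 : c.stk out = y) (h5 : c.stk tmp = z) : c = cfg l s x y z := by
  obtain ⟨l', s', S⟩ := c
  obtain rfl : l' = l := h1
  obtain rfl : s' = s := h2
  have : S = (cfg l' s' x y z).stk := by
    funext k
    cases k
    exacts [h3, h4, h5]
  rw [this]
  rfl

variable (a b c : List (Option Bool)) (s : Option (Option Bool))

lemma reaches_start : Reaches 1 (cfg (some start) s a b c)
    (cfg (some loop) s a (some false :: some true :: none :: some true :: none :: b) c) :=
  reaches_one (congrArg some (cfg_ext rfl rfl rfl rfl rfl))

lemma reaches_loop_cons (x : Option Bool) : Reaches 1 (cfg (some loop) s (x :: a) b c)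
    (cfg (some double) (some x) a b c) :=
  reaches_one (congrArg some (cfg_ext rfl rfl rfl rfl rfl))

lemma reaches_loop_nil : Reaches 1 (cfg (some loop) s [] b c) (cfg none none [] (none :: b) c) :=
  reaches_one (congrArg some (cfg_ext rfl rfl rfl rfl rfl))

lemma reaches_double_false : Reaches 1 (cfg (some double) s a (some false :: b) c)
    (cfg (some double) (some (some false)) a b (some false :: c)) :=
  reaches_one (congrArg some (cfg_ext rfl rfl rfl rfl rfl))

lemma reaches_double_true : Reaches 1 (cfg (some double) s a (some true :: b) c)
    (cfg (some back) (some (some true)) a (some true :: b) c) :=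
  reaches_one (congrArg some (cfg_ext rfl rfl rfl rfl rfl))

lemma reaches_back_cons (x : Option Bool) : Reaches 1 (cfg (some back) s a b (x :: c))
    (cfg (some back) (some x) a (some false :: some false :: b) c) :=
  reaches_one (congrArg some (cfg_ext rfl rfl rfl rfl rfl))

lemma reaches_back_nil : Reaches 1 (cfg (some back) s a b [])
    (cfg (some loop) none a b []) :=
  reaches_one (congrArg some (cfg_ext rfl rfl rfl rfl rfl))

/-- A block of `j` letters `false`. -/
def block (j : ℕ) : List (Option Bool) := List.replicate j (some false)

/-- One pass of `double` moves the block to `tmp`, in `j + 1` steps. -/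
lemma reaches_double (j : ℕ) : ∃ s', Reaches (j + 1)
    (cfg (some double) s a (block j ++ some true :: b) c)
    (cfg (some back) s' a (some true :: b) (block j ++ c)) := by
  induction j generalizing s c with
  | zero => exact ⟨_, reaches_double_true a b c s⟩
  | succ j ih =>
    obtain ⟨s', h⟩ := ih (some false :: c) (some (some false))
    refine ⟨s', ?_⟩
    have e : block (j + 1) ++ c = block j ++ some false :: c := by
      simp [block, List.replicate_succ', List.append_assoc]
    rw [e]
    exact (reaches_double_false a (block j ++ some true :: b) c s).trans h

lemma reaches_back (j : ℕ) : Reaches (j + 1)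
    (cfg (some back) s a b (block j)) (cfg (some loop) none a (block (2 * j) ++ b) []) := by
  induction j generalizing s b with
  | zero => exact reaches_back_nil a b s
  | succ j ih =>
    have e : block (2 * (j + 1)) ++ b = block (2 * j) ++ some false :: some false :: b := by
      rw [show 2 * (j + 1) = 2 * j + 1 + 1 by ring]
      simp [block, List.replicate_succ', List.append_assoc]
    rw [e]
    exact (reaches_back_cons a b (block j) s (some false)).trans
      (ih (some false :: some false :: b) _)

/-- The term `2 * j` on the left makes the bound inductive: it is the sum of a geometric series. -/
lemma reaches_loop (j : ℕ) : ∃ n, n + 2 * j ≤ 2 ^ (a.length + 1) * j + 3 * a.length + 1 ∧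
    Reaches n (cfg (some loop) s a (block j ++ some true :: b) [])
      (cfg none none [] (none :: (block (2 ^ a.length * j) ++ some true :: b)) []) := by
  induction a generalizing s j with
  | nil => exact ⟨1, by simp [add_comm], by simpa using reaches_loop_nil (block j ++ some true :: b) [] s⟩
  | cons x a ih =>
    obtain ⟨n, hn, h⟩ := ih none (2 * j)
    obtain ⟨s', h'⟩ := reaches_double a b [] (some x) j
    rw [List.append_nil] at h'
    have e : 2 ^ ((x :: a).length) * j = 2 ^ a.length * (2 * j) := by
      rw [List.length_cons]
      ring
    refine ⟨n + ((j + 1) + ((j + 1) + 1)), ?_, ?_⟩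
    · have e' : 2 ^ ((x :: a).length + 1) * j = 2 ^ (a.length + 1) * (2 * j) := by
        rw [List.length_cons]
        ring
      rw [e', List.length_cons]
      omega
    · rw [e]
      exact (((reaches_loop_cons a (block j ++ some true :: b) [] s x).trans h').trans
        (reaches_back a (some true :: b) s' j)).trans h

lemma bits_two_pow (j : ℕ) : Nat.bits (2 ^ j) = List.replicate j false ++ [true] := by
  induction j with
  | zero => simp
  | succ j ih =>
    rw [pow_succ', Nat.bit0_bits _ (by positivity), ih]
    rfl

lemma encodeRat_two_pow (j : ℕ) :
    encodeRat ((2 : ℚ) ^ j) = none :: (block j ++ [some true, none, some true, none]) := by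
  have h : ((2 : ℚ) ^ j) = ((2 ^ j : ℕ) : ℚ) := by push_cast; rfl
  have h2 : ratNumbers ((2 : ℚ) ^ j) = [0, 2 ^ j, 1] := by
    rw [h]
    simp only [ratNumbers, intNumbers, Rat.num_natCast, Rat.den_natCast]
    simp
  rw [encodeRat, h2]
  simp [encodeNumbers, bits_two_pow, block]

end PowerMachine

open PowerMachine in
/-- The number `2 ^ 2 ^ n`, where `n` is the length of the input, is computed in exponential
time. -/
theorem computableInExpTime_two_pow_two_pow {X : Type} (ea : X → List (Option Bool)) :
    ComputableInExpTime ea encodeRat fun x => (2 : ℚ) ^ 2 ^ (ea x).length := by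
  have key : ∀ a : List (Option Bool), ∃ n, n ≤ 2 ^ (a.length + 1) + 3 * a.length + 2 ∧
      Reaches n (Turing.initList machine a)
        (Turing.haltList machine (encodeRat ((2 : ℚ) ^ 2 ^ a.length))) := by
    intro a
    obtain ⟨n, hn, h⟩ := reaches_loop a [none, some true, none] none 1
    have h1 : Turing.initList machine a = cfg (some Label.start) none a [] [] :=
      cfg_ext rfl rfl rfl rfl rfl
    have h2 : Turing.haltList machine (encodeRat ((2 : ℚ) ^ 2 ^ a.length)) =
        cfg none none [] (encodeRat ((2 : ℚ) ^ 2 ^ a.length)) [] :=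
      cfg_ext rfl rfl rfl rfl rfl
    rw [h1, h2, encodeRat_two_pow]
    rw [mul_one] at h
    exact ⟨n + 1, by omega, (reaches_start a [] [] none).trans h⟩
  refine ⟨{ tm := machine
            inputAlphabet := Equiv.refl _
            outputAlphabet := Equiv.refl _
            time := fun n => 2 ^ (n + 1) + 3 * n + 2
            outputsFun := fun x =>
              { steps := (key (ea x)).choose
                evals_in_steps := ?_
                steps_le_m := (key (ea x)).choose_spec.1 } }, Polynomial.X + 3, fun n => ?_⟩
  · have h := (key (ea x)).choose_spec.2
    have e : ∀ l : List (Option Bool), l.map (Equiv.refl (Option Bool)).invFun = l :=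
      fun l => List.map_id l
    exact (congrArg (fun l => (flip bind machine.step)^[(key (ea x)).choose]
      (some (Turing.initList machine l))) (e (ea x))).trans
      (Eq.trans h (congrArg (fun l => some (Turing.haltList machine l)) (e _).symm))
  · have h1 : n + 1 ≤ 2 ^ n := Nat.lt_two_pow_self
    have h2 : 2 ^ (n + 3) = 8 * 2 ^ n := by ring
    have h3 : 2 ^ (n + 1) = 2 * 2 ^ n := by ring
    have h4 : Polynomial.eval n (Polynomial.X + 3 : Polynomial ℕ) = n + 3 := by simp
    simp only [h4]
    omega

/-! ### The size of a presentation -/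

lemma length_encodeNumbers (l : List ℕ) :
    (encodeNumbers l).length = (l.map fun n => n.size + 1).sum := by
  simp [encodeNumbers, List.length_flatMap, Nat.size_eq_bits_len]

lemma length_le_length_encodeNumbers (l : List ℕ) : l.length ≤ (encodeNumbers l).length := by
  rw [length_encodeNumbers]
  induction l with
  | nil => simp
  | cons a l ih =>
    simp only [List.length_cons, List.map_cons, List.sum_cons]
    omega

lemma lt_two_pow_length_encodeNumbers {l : List ℕ} {m : ℕ} (h : m ∈ l) :
    m < 2 ^ (encodeNumbers l).length := by
  refine (Nat.lt_size_self m).trans_le (Nat.pow_le_pow_right two_pos ?_)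
  have := List.single_le_sum (l := l.map fun n => n.size + 1) (by simp) (m.size + 1)
    (List.mem_map_of_mem h)
  rw [length_encodeNumbers]
  omega

lemma NNRat.cast_le_num (q : NNRat) : (q : ℝ) ≤ q.num := by
  have h : (q : ℝ) = (q.num : ℝ) / q.den := by
    conv_lhs => rw [← NNRat.num_div_den q]
    push_cast
    rfl
  rw [h]
  exact div_le_self (by positivity) (by exact_mod_cast q.den_pos)

namespace Presentation

variable (M : Presentation)

lemma length_stateNumbers (q : Fin M.numStates) : (stateNumbers M.automaton q).length = 11 := by
  simp [stateNumbers, ratNumbers, intNumbers]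

lemma length_numbers : M.numbers.length =
    4 + 11 * M.numStates + M.transitions.length * (3 + 2 * M.numVars) := by
  simp [numbers, List.length_flatMap, length_stateNumbers, transitionNumbers]
  ring

lemma size_le_length {t : Transition (Fin M.numStates) (Fin M.numSymbols) M.numVars}
    (ht : M.automaton.IsTransition t) :
    11 * M.numStates + 2 * M.numVars + 4 ≤ M.encode.length := by
  have h := length_le_length_encodeNumbers M.numbers
  rw [length_numbers] at h
  have h1 := List.length_pos_of_mem ((M.mem_transitions t).2 ht)
  have h2 := Nat.mul_le_mul_right (3 + 2 * M.numVars) h1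
  refine le_trans ?_ h
  omega

lemma params_le (q : Fin M.numStates) :
    ((M.automaton.params q).d : ℝ) + (M.automaton.params q).d' ≤ 2 * 2 ^ M.encode.length := by
  have key : ∀ m ∈ stateNumbers M.automaton q, (m : ℝ) ≤ 2 ^ M.encode.length := by
    intro m hm
    have : m ∈ M.numbers := by
      refine List.mem_append_left _ (List.mem_append_right _ (List.mem_flatMap.2 ⟨q, ?_, hm⟩))
      exact List.mem_finRange q
    exact_mod_cast (lt_two_pow_length_encodeNumbers this).le
  have h1 := NNRat.cast_le_num (M.automaton.params q).d
  have h2 := NNRat.cast_le_num (M.automaton.params q).d'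
  have h3 := key (M.automaton.params q).d.num (by simp [stateNumbers])
  have h4 := key (M.automaton.params q).d'.num (by simp [stateNumbers])
  linarith

end Presentation

lemma sq_le_two_pow {n : ℕ} (hn : 4 ≤ n) : n ^ 2 ≤ 2 ^ n := by
  induction n, hn using Nat.le_induction with
  | base => norm_num
  | succ n hn ih =>
    rw [pow_succ 2 n]
    nlinarith

/-- The bound on the privacy loss, for `s` states with `k` variables and parameters below `2 ^ n`,
is below `2 ^ 2 ^ n`. -/
lemma privacyLoss_le_two_pow_two_pow {n s k : ℕ} (hs : 1 ≤ s) (h : 11 * s + 2 * k + 4 ≤ n) :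
    (k + 1) * (s * 2 ^ (k * k)) * (2 * (2 * 2 ^ n)) ≤ 2 ^ 2 ^ n := by
  have h1 : (k + 1) * s ≤ 2 ^ n := by
    refine le_trans ?_ (sq_le_two_pow (by omega))
    rw [pow_two]
    exact Nat.mul_le_mul (by omega) (by omega)
  have h2 : n + k * k + (n + 2) ≤ 2 ^ n := by
    refine le_trans ?_ (sq_le_two_pow (by omega))
    nlinarith
  calc (k + 1) * (s * 2 ^ (k * k)) * (2 * (2 * 2 ^ n))
      = ((k + 1) * s) * 2 ^ (k * k) * 2 ^ (n + 2) := by ring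
    _ ≤ 2 ^ n * 2 ^ (k * k) * 2 ^ (n + 2) := by gcongr
    _ = 2 ^ (n + k * k + (n + 2)) := by rw [← pow_add, ← pow_add]
    _ ≤ 2 ^ 2 ^ n := Nat.pow_le_pow_right two_pos h2

theorem DiPA.WellFormed.exists_differentiallyPrivate {Q Γ : Type*} [Finite Q] {k : ℕ}
    {A : DiPA Q Γ k} (hA : A.WellFormed) (hI : A.Initialized) :
    ∃ D : ℝ, 0 < D ∧ ∀ ε : ℝ, 0 < ε → A.DifferentiallyPrivate D ε := by
  have := Fintype.ofFinite Q
  have h0 : ∀ q, (0 : ℝ) ≤ ((A.params q).d : ℝ) + (A.params q).d' := fun q => by positivity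
  set W : ℝ := ∑ q, (((A.params q).d : ℝ) + (A.params q).d')
  have hW0 : 0 ≤ W := Finset.sum_nonneg fun q _ => h0 q
  refine ⟨((k + 1) * (Nat.card Q * 2 ^ (k * k)) : ℕ) * (2 * W) + 1, by positivity,
    fun ε hε => ?_⟩
  exact hA.differentiallyPrivate hI hW0
    (fun t _ => Finset.single_le_sum (fun q _ => h0 q) (Finset.mem_univ t.src))
    (le_add_of_nonneg_right zero_le_one) hε

/-- A privacy loss that depends only on the length of the encoding. -/
lemma Presentation.differentiallyPrivate (M : Presentation) (hI : M.automaton.Initialized)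
    (hA : M.automaton.WellFormed) {ε : ℝ} (hε : 0 < ε) :
    M.automaton.DifferentiallyPrivate (2 ^ 2 ^ M.encode.length) ε := by
  by_cases ht : ∃ t, M.automaton.IsTransition t
  · obtain ⟨t, ht⟩ := ht
    refine hA.differentiallyPrivate hI (W := 2 * 2 ^ M.encode.length) (by positivity)
      (fun t _ => M.params_le t.src) ?_ hε
    rw [Nat.card_eq_fintype_card, Fintype.card_fin]
    have h := privacyLoss_le_two_pow_two_pow (Fin.pos M.automaton.init) (M.size_le_length ht)
    exact_mod_cast h
  · -- Without transitions, the number of variables can be exponential in the length of the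
    -- encoding, but there is only the empty run.
    refine hA.differentiallyPrivate hI (W := 0) le_rfl (fun t h => (ht ⟨t, h⟩).elim) ?_ hε
    rw [mul_zero, mul_zero]
    positivity

theorem theorem5p1 :
    (∀ (Q Γ : Type*) [Finite Q] [Finite Γ] (k : ℕ) (A : DiPA Q Γ k),
      A.Initialized → A.StrongFeasibility → A.WellFormed →
        ∃ D : ℝ, 0 < D ∧ ∀ ε : ℝ, 0 < ε → A.DifferentiallyPrivate D ε) ∧
    (∃ D : Presentation → ℚ,
      ComputableInExpTime Presentation.encode encodeRat D ∧
      ∀ M : Presentation,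
        M.automaton.Initialized → M.automaton.StrongFeasibility → M.automaton.WellFormed →
          0 < D M ∧
            ∀ ε : ℝ, 0 < ε → M.automaton.DifferentiallyPrivate ((D M : ℚ) : ℝ) ε) := by
  refine ⟨fun Q Γ _ _ k A hI _ hA => hA.exists_differentiallyPrivate hI,
    fun M => 2 ^ 2 ^ M.encode.length, computableInExpTime_two_pow_two_pow Presentation.encode,
    fun M hI _ hA => ⟨by positivity, fun ε hε => ?_⟩⟩
  have h := M.differentiallyPrivate hI hA hε
  push_cast
  exact h
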